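/- Let $\langle x,y\rangle=x_1y_1+\dots+x_{n+1}y_{n+1}-x_{n+2}y_{n+2}$ on $\mathbb R^{n+2}$ and let $\mathcal M^n=\{[x]\in\mathbb R\mathrm P^{n+1}:\langle x,x\rangle=0\}$ be the Möbius quadric. An $m$-sphere is the intersection of $\mathcal M^n$ with an $(m+1)$-dimensional projective subspace ($m=1$: circle; $m=0$: pair of points); it may be imaginary. A Darboux cyclide (of dimension $n-1$) in $\mathcal M^n$ is $\mathcal D=\mathcal Q\cap\mathcal M^n$ with $\mathcal Q\neq\mathcal M^n$ a real quadric hypersurface. A sphere $\mathcal S$ touches $\mathcal D$ at a (real or complex) point $p$ if $p$ lies on the complexifications of both, $\mathcal D$ is smooth at $p$ and $T_p\mathcal S\subset T_p\mathcal D$. Let $M:\mathbb Z^2\to\mathcal M^n$, $n\in\{3,4,5\}$, be a circular net, i.e. $M_{i,j},M_{i+1,j},M_{i+1,j+1},M_{i,j+1}$ always lie on a circle. For every $i$ let the points $\{M_{i,j}\}_{j}$ lie on a 2-sphere $\mathcal V_i=V_i\cap\mathcal M^n$, and for every $j$ let the points $\{M_{i,j}\}_{i}$ lie on a 2-sphere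 $\mathcal H_j=H_j\cap\mathcal M^n$, where $V_i,H_j\subset\mathbb R\mathrm P^{n+1}$ are 3-dimensional projective subspaces. Assume that the net is in general position: the four vertices of each elementary quadrilateral are distinct, any four consecutive vertices on a parameter line span a 3-dimensional projective subspace, $V_i\ne V_{i+1}$ and $H_j\neq H_{j+1}$ for all $i,j$, and the net is not contained in a hypersphere. If $n\in\{3,4\}$, assume moreover that each of the families $(V_i)_i$ and $(H_j)_j$, written $(U_i)_i$, is in general position: $\bigcap_i U_i$ is a single point $Y$, the spheres $U_i\cap\mathcal M^n$ have no common point, and no singular quadric in the polar hyperplane $Y^\perp$ (with respect to $\mathcal M^n$) contains all the polar subspaces $U_i^\perp\subset Y^\perp$. (i) If $n=5$, there is a 4-dimensional Darboux cyclide that contains all the spheres $\mathcal V_i$ and $\mathcal H_j$. (ii) If $n=4$, there is a 3-dimensional Darboux cyclide $\mathcal D$ such that each of the spheres $\mathcal V_i$ and $\mathcal H_j$ is not contained in $\mathcal D$ and touches $\mathcal D$ along all the (real or complex) points of a circle on that sphere. (iii) If $n=3$, there is a 2-dimensional Darboux cyclide $\mathcal D$ such that each of the spheres $\mathcal V_i$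 and $\mathcal H_j$ is not contained in $\mathcal D$ and touches $\mathcal D$ at the two (real or complex, counted with multiplicity) points in which some line in $V_i$, respectively $H_j$, meets $\mathcal M^3$. In (ii) and (iii), the circle is non-degenerate, respectively the two points are distinct, for every member $U_i$ of the respective family such that, for each quadric in $Y^\perp$ containing all the polar subspaces $U_k^\perp$, its tangent space along $U_i^\perp$ is not tangent to $\mathcal M^n$. -/

import Mathlib

open scoped Matrix

namespace DarbouxNet

/-- The vector space `ℝ^{n+1,1}` of homogeneous coordinates. -/
abbrev Amb (n : ℕ) : Type := Fin (n + 2) → ℝ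

/-- The projective space `ℝP^{n+1}`. -/
abbrev ProjSpace (n : ℕ) : Type := Projectivization ℝ (Amb n)

/-- The symmetric matrix of the Lorentz product
`⟨x, y⟩ = x₁ y₁ + ⋯ + x_{n+1} y_{n+1} - x_{n+2} y_{n+2}`. -/
def lorentz (n : ℕ) : Matrix (Fin (n + 2)) (Fin (n + 2)) ℝ :=
  Matrix.diagonal fun i => if i = Fin.last (n + 1) then -1 else 1

/-- The bilinear form with matrix `A`. -/
def form {n : ℕ} (A : Matrix (Fin (n + 2)) (Fin (n + 2)) ℝ) (x y : Fin (n + 2) → ℝ) : ℝ :=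
  x ⬝ᵥ (A *ᵥ y)

/-- The complex bilinear extension of the bilinear form with real matrix `A`. -/
def formC {n : ℕ} (A : Matrix (Fin (n + 2)) (Fin (n + 2)) ℝ) (x y : Fin (n + 2) → ℂ) : ℂ :=
  x ⬝ᵥ (A.map (fun r : ℝ => (r : ℂ)) *ᵥ y)

/-- The quadric in `ℝP^{n+1}` given by a matrix. -/
def quadric {n : ℕ} (A : Matrix (Fin (n + 2)) (Fin (n + 2)) ℝ) : Set (ProjSpace n) :=
  {p | form A p.rep p.rep = 0}

/-- The Möbius quadric `𝓜ⁿ ⊂ ℝP^{n+1}`. -/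
def mobiusQuadric (n : ℕ) : Set (ProjSpace n) := quadric (lorentz n)

/-- The sphere cut out of the Möbius quadric by the projective subspace `P(U)`. It is an
`(m - 1)`-dimensional sphere when `P(U)` has dimension `m`, i.e. when `U` has dimension `m + 1`:
a 2-sphere for `dim U = 4`, a circle for `dim U = 3`, a pair of points for `dim U = 2`. -/
def sphereOf (n : ℕ) (U : Submodule ℝ (Amb n)) : Set (ProjSpace n) :=
  {p | p.submodule ≤ U} ∩ mobiusQuadric n

/-- `B` is the matrix of a quadric hypersurface that is different from the Möbius quadric. -/
def IsCyclideMatrix (n : ℕ) (B : Matrix (Fin (n + 2)) (Fin (n + 2)) ℝ) : Prop :=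
  B.IsSymm ∧ ∀ c : ℝ, B ≠ c • lorentz n

/-- The Darboux cyclide cut out of the Möbius quadric by the quadric with matrix `B`. -/
def darbouxCyclide (n : ℕ) (B : Matrix (Fin (n + 2)) (Fin (n + 2)) ℝ) : Set (ProjSpace n) :=
  quadric B ∩ mobiusQuadric n

/-- The complexification of a real linear subspace. -/
def complexify {n : ℕ} (U : Submodule ℝ (Amb n)) : Submodule ℂ (Fin (n + 2) → ℂ) :=
  Submodule.span ℂ ((fun (x : Amb n) (k : Fin (n + 2)) => (x k : ℂ)) '' (U : Set (Amb n)))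

/-- The (complexified) sphere cut out by `P(U)` touches the (complexified) Darboux cyclide given
by `B` at the complex point `[p]`: the point lies on both of them, the cyclide is smooth there
(the differentials of its two equations are linearly independent), and the tangent space of the
sphere is contained in the tangent space of the cyclide. -/
def TouchesAt (n : ℕ) (B : Matrix (Fin (n + 2)) (Fin (n + 2)) ℝ) (U : Submodule ℝ (Amb n))
    (p : Fin (n + 2) → ℂ) : Prop :=
  p ∈ complexify U ∧ formC (lorentz n) p p = 0 ∧ formC B p p = 0 ∧
    LinearIndependent ℂ ![(lorentz n).map (fun r : ℝ => (r : ℂ)) *ᵥ p,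
      B.map (fun r : ℝ => (r : ℂ)) *ᵥ p] ∧
    ∀ v ∈ complexify U, formC (lorentz n) p v = 0 → formC B p v = 0

/-- The sphere cut out by `P(U)` touches the Darboux cyclide given by `B` along the points of the
subsphere cut out by `P(E)` (real or imaginary points); the sphere is not part of the cyclide. -/
def TouchesAlong (n : ℕ) (B : Matrix (Fin (n + 2)) (Fin (n + 2)) ℝ)
    (U E : Submodule ℝ (Amb n)) : Prop :=
  E ≤ U ∧ ¬ sphereOf n U ⊆ darbouxCyclide n B ∧
    ∀ p ∈ complexify E, p ≠ 0 → formC (lorentz n) p p = 0 → TouchesAt n B U p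

/-- A circular net: a net in the Möbius quadric such that the four vertices of each elementary
quadrilateral are coplanar in `ℝP^{n+1}`, i.e. lie on a circle of the Möbius quadric. -/
structure IsCircularNet (n : ℕ) (M : ℤ → ℤ → ProjSpace n) : Prop where
  mem_mobius : ∀ i j, M i j ∈ mobiusQuadric n
  circular : ∀ i j, Module.finrank ℝ
    ((M i j).submodule ⊔ (M (i + 1) j).submodule ⊔ (M (i + 1) (j + 1)).submodule ⊔
      (M i (j + 1)).submodule : Submodule ℝ (Amb n)) ≤ 3

/-- General position of the vertices of a net whose parameter lines lie in the subspaces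
`P(V i)` and `P(H j)`. -/
structure NetInGeneralPosition (n : ℕ) (M : ℤ → ℤ → ProjSpace n)
    (V H : ℤ → Submodule ℝ (Amb n)) : Prop where
  /-- the vertices of each elementary quadrilateral are distinct -/
  quad_distinct : ∀ i j, M i j ≠ M (i + 1) j ∧ M i j ≠ M i (j + 1) ∧
    M i j ≠ M (i + 1) (j + 1) ∧ M (i + 1) j ≠ M i (j + 1)
  /-- four consecutive vertices on a parameter line are not concircular -/
  row_span : ∀ i j, Module.finrank ℝ
    (⨆ k : Fin 4, (M (i + ((k : ℕ) : ℤ)) j).submodule : Submodule ℝ (Amb n)) = 4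
  col_span : ∀ i j, Module.finrank ℝ
    (⨆ k : Fin 4, (M i (j + ((k : ℕ) : ℤ))).submodule : Submodule ℝ (Amb n)) = 4
  /-- consecutive spheres of each family are distinct -/
  adjacent_V : ∀ i, V i ≠ V (i + 1)
  adjacent_H : ∀ j, H j ≠ H (j + 1)
  /-- the net is not contained in a hypersphere of the Möbius quadric -/
  net_span : (⨆ i : ℤ, ⨆ j : ℤ, (M i j).submodule) = ⊤

/-- The polar subspace with respect to the Möbius quadric. -/
def polarSpace (n : ℕ) (U : Submodule ℝ (Amb n)) : Submodule ℝ (Amb n) where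
  carrier := {x | ∀ u ∈ U, form (lorentz n) u x = 0}
  add_mem' := by
    intro a b ha hb u hu
    have h1 := ha u hu
    have h2 := hb u hu
    simp only [form, Matrix.mulVec_add, dotProduct_add] at *
    rw [h1, h2, add_zero]
  zero_mem' := by
    intro u _
    simp [form]
  smul_mem' := by
    intro c x hx u hu
    have h1 := hx u hu
    simp only [form, Matrix.mulVec_smul, dotProduct_smul] at *
    rw [h1, smul_zero]

/-- `Ψ` defines a quadric in the polar space of `P(⋂ U i)` that contains the polar spaces of all
the `P(U i)` (these are subspaces of the former). -/
def ContainsPolars (n : ℕ) (U : ℤ → Submodule ℝ (Amb n))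
    (Ψ : LinearMap.BilinForm ℝ (polarSpace n (⨅ i, U i))) : Prop :=
  (∀ x y, Ψ x y = Ψ y x) ∧ Ψ ≠ 0 ∧
    ∀ i, ∀ x : polarSpace n (⨅ i, U i), (x : Amb n) ∈ polarSpace n (U i) → Ψ x x = 0

/-- General position of a family of spheres, cut out by the subspaces `P(U i)`: the subspaces
have exactly one common point `Y`, the spheres have no common point, and no singular quadric in
the polar hyperplane of `Y` contains all the polar spaces of the `P(U i)`. -/
structure FamilyInGeneralPosition (n : ℕ) (U : ℤ → Submodule ℝ (Amb n)) : Prop where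
  common_point : Module.finrank ℝ (⨅ i, U i : Submodule ℝ (Amb n)) = 1
  no_common_point_on_spheres : (⋂ i, sphereOf n (U i)) = ∅
  polar_quadric : ∀ Ψ, ContainsPolars n U Ψ → ∀ z, (∀ w, Ψ z w = 0) → z = 0

/-- The subspace `P(E)` is not tangent to the Möbius quadric: the Lorentz product is
non-degenerate on `E`. For `dim E = 3` it cuts out a non-degenerate (real or imaginary) circle,
for `dim E = 2` two distinct (real or complex conjugate) points. -/
def IsTransversal (n : ℕ) (E : Submodule ℝ (Amb n)) : Prop :=
  ∀ x ∈ E, (∀ y ∈ E, form (lorentz n) x y = 0) → x = 0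

/-- If a quadric contains the polar spaces of all the `P(U i)`, then its tangent space along the
polar space of the `i`-th one is not tangent to the Möbius quadric. -/
def PolarTangentTransversal (n : ℕ) (U : ℤ → Submodule ℝ (Amb n)) (i : ℤ) : Prop :=
  ∀ Ψ, ContainsPolars n U Ψ → ∀ T : Submodule ℝ (Amb n),
    (∀ w, w ∈ T ↔ ∃ z : polarSpace n (⨅ i, U i), (z : Amb n) = w ∧
      ∀ x : polarSpace n (⨅ i, U i), (x : Amb n) ∈ polarSpace n (U i) → Ψ x z = 0) →
    IsTransversal n T

end DarbouxNet

/-! Two 4-dimensional spaces `V 0` and `H 0` sharing exactly one vertex line span a space of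
dimension 4 + 4 - 1 = 7. In dimension 7, the case n = 5, a symmetric form `L` vanishing at all
vertices splits as `L = B + (L - B)` with `B` zero on every `V i` and `L - B` zero on every `H j`
(`IsQNet.exists_form`). With `L` the Lorentz product, `B` defines the cyclide: it vanishes on the `V
i`, and on the `H j` it equals the Lorentz product.

For n < 5 the net is a projection, along some map π, of a net of the same kind in dimension 7
(`IsQNet.exists_lift`). The splitting is applied there to the pullback `L` of the Lorentz product.
Let N = ker π. Since `L` vanishes on N, the forms `B` and `L - B` have the same orthogonal space of
N. If N is nondegenerate for `B`, then π maps this orthogonal space isomorphically onto the ambient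
space, and `B` induces there a form `A`, whose quadric is the apparent contour of `B` seen from N;
likewise `L - B` induces ⟨·,·⟩ - `A`. A subspace isotropic upstairs projects to one that is tangent
to the contour along the image of its intersection with the orthogonal space of N. The two contours
lie in one pencil with the Möbius quadric, hence cut out the same cyclide, and both families of
spheres touch it.

General position gives the nondegeneracy of N (`IsIsotropicLift.eq_zero_of_mem_ker`). The radical of
`B` is a line over the common point Y, and the inverse of `B` yields a quadric in the polar
hyperplane of Y that contains all polar spaces. A degenerate N would make this dual quadric
singular. The tangent space of the dual quadric along a polar space is the polar space of the
contact subspace, which gives the transversality criterion. -/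

namespace DarbouxNet

/-! ### Gluing of linear maps, Q-nets with 4-dimensional parameter spaces, and the splitting of a
form in dimension 7. -/

open Submodule Module

variable {Z Z' : Type*} [AddCommGroup Z] [Module ℝ Z] [AddCommGroup Z'] [Module ℝ Z']

/-- Linear maps that agree on the intersection of two subspaces can be glued. -/
theorem exists_linearMap_glue (A B : Submodule ℝ Z) (f g : Z →ₗ[ℝ] Z')
    (hfg : ∀ x ∈ A, x ∈ B → f x = g x) :
    ∃ s : Z →ₗ[ℝ] Z', (∀ x ∈ A, s x = f x) ∧ ∀ x ∈ B, s x = g x := by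
  let F : Z →ₗ.[ℝ] Z' := ⟨A, f.comp A.subtype⟩
  let G : Z →ₗ.[ℝ] Z' := ⟨B, g.comp B.subtype⟩
  have h : ∀ (x : F.domain) (y : G.domain), (x : Z) = y → F x = G y := by
    rintro ⟨x, hx⟩ ⟨y, hy⟩ hxy
    obtain rfl : x = y := hxy
    exact hfg x hx hy
  obtain ⟨s, hs⟩ := LinearMap.exists_extend (F.sup G h).toFun
  have hs' : ∀ x : (F.sup G h).domain, s x = (F.sup G h) x := fun x => LinearMap.congr_fun hs x
  refine ⟨s, fun x hx => ?_, fun x hx => ?_⟩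
  · have h1 := (LinearPMap.left_le_sup F G h).2 (x := ⟨x, hx⟩)
      (y := ⟨x, (LinearPMap.left_le_sup F G h).1 hx⟩) rfl
    exact (hs' ⟨x, _⟩).trans h1.symm
  · have h1 := (LinearPMap.right_le_sup F G h).2 (x := ⟨x, hx⟩)
      (y := ⟨x, (LinearPMap.right_le_sup F G h).1 hx⟩) rfl
    exact (hs' ⟨x, _⟩).trans h1.symm

/-- A linear map can be prescribed on a linearly independent family. -/
theorem exists_linearMap_of_linearIndependent {ι : Type*} {b : ι → Z}
    (hb : LinearIndependent ℝ b) (s : ι → Z') : ∃ S : Z →ₗ[ℝ] Z', ∀ k, S (b k) = s k := by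
  obtain ⟨g, hg⟩ := (Finsupp.linearCombination ℝ b).exists_leftInverse_of_injective
    (LinearMap.ker_eq_bot.2 hb)
  refine ⟨(Finsupp.linearCombination ℝ s).comp g, fun k => ?_⟩
  have := LinearMap.congr_fun hg (Finsupp.single k 1)
  simp at this
  simp [this]

/-- A net with planar elementary quadrilaterals, given by homogeneous coordinate vectors, whose
parameter lines span the four-dimensional subspaces `V i` and `H j`. -/
structure IsQNet (m : ℤ → ℤ → Z) (V H : ℤ → Submodule ℝ Z) : Prop where
  span_V : ∀ i j, span ℝ (Set.range fun k : Fin 4 => m i (j + ((k : ℕ) : ℤ))) = V i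
  span_H : ∀ i j, span ℝ (Set.range fun k : Fin 4 => m (i + ((k : ℕ) : ℤ)) j) = H j
  finrank_V : ∀ i, finrank ℝ (V i) = 4
  finrank_H : ∀ j, finrank ℝ (H j) = 4
  V_ne : ∀ i, V i ≠ V (i + 1)
  H_ne : ∀ j, H j ≠ H (j + 1)
  quad : ∀ i j, ∃ a b c d : ℝ, a ≠ 0 ∧ b ≠ 0 ∧ c ≠ 0 ∧ d ≠ 0 ∧
    a • m i j + b • m (i + 1) j + c • m (i + 1) (j + 1) + d • m i (j + 1) = 0

/-- Two polygons whose corresponding edges, together, are planar quadrilaterals without collinear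
triples of vertices. -/
def ArePlanarStrip (p q : ℤ → Z) : Prop :=
  ∀ j, ∃ a b c d : ℝ, a ≠ 0 ∧ b ≠ 0 ∧ c ≠ 0 ∧ d ≠ 0 ∧
    a • p j + b • q j + c • q (j + 1) + d • p (j + 1) = 0

theorem ArePlanarStrip.symm {p q : ℤ → Z} (h : ArePlanarStrip p q) : ArePlanarStrip q p := by
  intro j
  obtain ⟨a, b, c, d, ha, hb, hc, hd, h⟩ := h j
  exact ⟨b, a, d, c, hb, ha, hd, hc, by rw [← h]; abel⟩

theorem mem_of_smul_mem' {A : Submodule ℝ Z} {a : ℝ} (ha : a ≠ 0) {x : Z} (h : a • x ∈ A) :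
    x ∈ A := (A.smul_mem_iff ha).1 h

/-- Every edge line of `p` meets the corresponding edge line of `q` in a point of `A ⊓ B` whose
coefficients on the edge are both nonzero. Modulo `A ⊓ B`, consecutive vertices of `p` are therefore
proportional. -/
theorem ArePlanarStrip.mem_sup {p q : ℤ → Z} (h : ArePlanarStrip p q) {A B : Submodule ℝ Z}
    (hp : ∀ j, p j ∈ A) (hq : ∀ j, q j ∈ B) (j k : ℤ) : p k ∈ span ℝ {p j} ⊔ (A ⊓ B) := by
  have key : ∀ k, ∃ a d : ℝ, a ≠ 0 ∧ d ≠ 0 ∧ a • p k + d • p (k + 1) ∈ A ⊓ B := by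
    intro k
    obtain ⟨a, b, c, d, ha, hb, hc, hd, h⟩ := h k
    refine ⟨a, d, ha, hd, A.add_mem (A.smul_mem _ (hp _)) (A.smul_mem _ (hp _)), ?_⟩
    have e : a • p k + d • p (k + 1) = -(b • q k + c • q (k + 1)) := by
      rw [eq_neg_iff_add_eq_zero, ← h]; abel
    rw [e]
    exact B.neg_mem (B.add_mem (B.smul_mem _ (hq _)) (B.smul_mem _ (hq _)))
  have keyS : ∀ k, ∃ a d : ℝ, a ≠ 0 ∧ d ≠ 0 ∧
      a • p k + d • p (k + 1) ∈ span ℝ {p j} ⊔ (A ⊓ B) := fun k => by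
    obtain ⟨a, d, ha, hd, h⟩ := key k
    exact ⟨a, d, ha, hd, le_sup_right (a := span ℝ {p j}) h⟩
  induction k using Int.inductionOn' (b := j) with
  | zero => exact mem_sup_left (mem_span_singleton_self _)
  | succ k _ ih =>
    obtain ⟨a, d, ha, hd, h⟩ := keyS k
    exact mem_of_smul_mem' hd ((Submodule.add_mem_iff_right _ (smul_mem _ a ih)).1 h)
  | pred k _ ih =>
    obtain ⟨a, d, ha, hd, h⟩ := keyS (k - 1)
    rw [sub_add_cancel] at h
    exact mem_of_smul_mem' ha ((Submodule.add_mem_iff_left _ (smul_mem _ d ih)).1 h)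

namespace IsQNet

variable {m : ℤ → ℤ → Z} {V H : ℤ → Submodule ℝ Z}

theorem swap (h : IsQNet m V H) : IsQNet (fun i j => m j i) H V where
  span_V i j := h.span_H j i
  span_H i j := h.span_V j i
  finrank_V := h.finrank_H
  finrank_H := h.finrank_V
  V_ne := h.H_ne
  H_ne := h.V_ne
  quad i j := by
    obtain ⟨a, b, c, d, ha, hb, hc, hd, h⟩ := h.quad j i
    exact ⟨a, d, c, b, ha, hd, hc, hb, by rw [← h]; abel⟩

theorem strip (h : IsQNet m V H) (i : ℤ) : ArePlanarStrip (m i) (m (i + 1)) := h.quad i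

theorem mem_V (h : IsQNet m V H) (i j : ℤ) : m i j ∈ V i := by
  rw [← h.span_V i j]
  exact subset_span ⟨0, by simp⟩

theorem mem_H (h : IsQNet m V H) (i j : ℤ) : m i j ∈ H j := h.swap.mem_V j i

theorem V_le (h : IsQNet m V H) {i : ℤ} {A : Submodule ℝ Z} (hA : ∀ j, m i j ∈ A) : V i ≤ A := by
  rw [← h.span_V i 0, span_le]
  rintro _ ⟨k, rfl⟩
  exact hA _

theorem V_le_sup_succ (h : IsQNet m V H) (i j : ℤ) :
    V i ≤ span ℝ {m i j} ⊔ (V i ⊓ V (i + 1)) :=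
  h.V_le fun k => (h.strip i).mem_sup (h.mem_V i) (h.mem_V (i + 1)) j k

theorem V_succ_le_sup (h : IsQNet m V H) (i j : ℤ) :
    V (i + 1) ≤ span ℝ {m (i + 1) j} ⊔ (V i ⊓ V (i + 1)) :=
  h.V_le fun k => inf_comm (V i) _ ▸
    (h.strip i).symm.mem_sup (h.mem_V (i + 1)) (h.mem_V i) j k

theorem finiteDimensional_V (h : IsQNet m V H) (i : ℤ) : FiniteDimensional ℝ (V i) :=
  FiniteDimensional.of_finrank_pos (by rw [h.finrank_V]; norm_num)

/-- One vertex together with `V i ⊓ V (i + 1)` generates `V i`; a vertex in the neighbouring space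
would make the two spaces equal. -/
theorem notMem_V_succ (h : IsQNet m V H) (i j : ℤ) : m i j ∉ V (i + 1) := by
  intro hm
  have := h.finiteDimensional_V (i + 1)
  refine h.V_ne i (eq_of_le_of_finrank_eq ((h.V_le_sup_succ i j).trans (sup_le ?_ inf_le_right))
    (by rw [h.finrank_V, h.finrank_V]))
  rwa [span_singleton_le_iff_mem]

theorem notMem_V_pred (h : IsQNet m V H) (i j : ℤ) : m (i + 1) j ∉ V i := by
  intro hm
  have := h.finiteDimensional_V i
  refine h.V_ne i (eq_of_le_of_finrank_eq ((h.V_succ_le_sup i j).trans (sup_le ?_ inf_le_left))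
    (by rw [h.finrank_V, h.finrank_V])).symm
  rwa [span_singleton_le_iff_mem]

theorem ne_zero (h : IsQNet m V H) (i j : ℤ) : m i j ≠ 0 :=
  fun h0 => h.notMem_V_succ i j (h0 ▸ zero_mem _)

/-- Passing from one space to its neighbour adds only a single vertex, which can be chosen in `H j`.
-/
theorem V_sup_H_le (h : IsQNet m V H) (i j : ℤ) : V i ≤ V 0 ⊔ H j := by
  induction i using Int.induction_on with
  | zero => exact le_sup_left
  | succ i ih =>
    refine (h.V_succ_le_sup i j).trans (sup_le ?_ (inf_le_left.trans ih))
    rw [span_singleton_le_iff_mem]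
    exact mem_sup_right (h.mem_H _ _)
  | pred i ih =>
    have := h.V_le_sup_succ (-i - 1) j
    rw [sub_add_cancel] at this
    refine this.trans (sup_le ?_ (inf_le_right.trans ih))
    rw [span_singleton_le_iff_mem]
    exact mem_sup_right (h.mem_H _ _)

/-- The net with the first parameter shifted. -/
theorem shift (h : IsQNet m V H) (s : ℤ) :
    IsQNet (fun i j => m (s + i) j) (fun i => V (s + i)) H where
  span_V i j := h.span_V (s + i) j
  span_H i j := by simpa only [add_assoc] using h.span_H (s + i) j
  finrank_V i := h.finrank_V _
  finrank_H := h.finrank_H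
  V_ne i := by simpa only [add_assoc] using h.V_ne (s + i)
  H_ne := h.H_ne
  quad i j := by simpa only [add_assoc] using h.quad (s + i) j

theorem V_sup_H (h : IsQNet m V H) (htop : V 0 ⊔ H 0 = ⊤) (i : ℤ) : V i ⊔ H 0 = ⊤ := by
  rw [eq_top_iff, ← htop]
  refine sup_le ?_ le_sup_right
  -- Seen from index `i`, the space `V 0` has index `-i`, so it lies in `V i ⊔ H 0`.
  simpa using (h.shift i).V_sup_H_le (-i) 0

/-- Dimension count: 4 + 4 - 7 = 1. -/
theorem V_inf_H [FiniteDimensional ℝ Z] (h : IsQNet m V H) (hZ : finrank ℝ Z = 7)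
    (htop : V 0 ⊔ H 0 = ⊤) (i : ℤ) : V i ⊓ H 0 = span ℝ {m i 0} := by
  symm
  apply eq_of_le_of_finrank_eq
  · rw [span_singleton_le_iff_mem]
    exact ⟨h.mem_V _ _, h.mem_H _ _⟩
  · have := finrank_sup_add_finrank_inf_eq (V i) (H 0)
    rw [h.V_sup_H htop, finrank_top, h.finrank_V, h.finrank_H, hZ] at this
    rw [finrank_span_singleton (h.ne_zero _ _)]
    omega

theorem linearIndependent_V (h : IsQNet m V H) (i j : ℤ) :
    LinearIndependent ℝ fun k : Fin 4 => m i (j + ((k : ℕ) : ℤ)) := by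
  rw [linearIndependent_iff_card_eq_finrank_span, Set.finrank, h.span_V, h.finrank_V]
  rfl

end IsQNet

/-- A symmetric form for which the vertices of the quadrilaterals of a planar strip are isotropic,
and which vanishes on one polygon of the strip, also vanishes on the other one. -/
theorem ArePlanarStrip.form_eq_zero {p q : ℤ → Z} (h : ArePlanarStrip p q)
    {C : LinearMap.BilinForm ℝ Z} (hC : ∀ x y, C x y = C y x) (l N : ℕ)
    (hp : ∀ i k : ℕ, i ≤ N → k ≤ N → C (p i) (p k) = 0) (hq : ∀ i : ℕ, i ≤ N → C (q i) (q i) = 0)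
    (i : ℕ) (hl : i + l ≤ N) : C (q i) (q ((i + l : ℕ) : ℤ)) = 0 := by
  induction l using Nat.strong_induction_on generalizing i with
  | _ l ih =>
  match l, ih with
  | 0, _ => exact hq i (by omega)
  | 1, _ =>
    -- The intersection of the two edge lines is a third isotropic point on the edge of `q`, besides
    -- its endpoints, so the whole edge is isotropic.
    obtain ⟨a, b, c, d, ha, hb, hc, hd, h⟩ := h i
    have e : a • p i + d • p (i + 1) = -(b • q i + c • q (i + 1)) := by
      rw [eq_neg_iff_add_eq_zero, ← h]; abel
    have h1 : C (a • p i + d • p (i + 1)) (a • p i + d • p (i + 1)) = 0 := by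
      have h11 := hp i i (by omega) (by omega)
      have h12 := hp i (i + 1) (by omega) (by omega)
      have h22 := hp (i + 1) (i + 1) (by omega) (by omega)
      have h21 := hp (i + 1) i (by omega) (by omega)
      push_cast at h12 h22 h21
      simp [h11, h12, h22, h21]
    have g11 := hq i (by omega)
    have g22 := hq (i + 1) (by omega)
    push_cast at g22 ⊢
    rw [e] at h1
    simp only [map_neg, LinearMap.neg_apply, map_add, map_smul, LinearMap.add_apply,
      LinearMap.smul_apply, smul_eq_mul, g11, g22, hC (q (i + 1)) (q i)] at h1
    have : (2 * (b * c)) * C (q i) (q (i + 1)) = 0 := by linarith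
    simpa [hb, hc] using this
  | l + 2, ih =>
    -- The intersection points belonging to edges `i` and `i + l + 1` lie on edge lines of `p`,
    -- hence are conjugate. Expanded in the vertices of `q`, all terms but the one at distance `l +
    -- 2` vanish by induction.
    obtain ⟨a, b, c, d, ha, hb, hc, hd, h1⟩ := h i
    obtain ⟨a', b', c', d', ha', hb', hc', hd', h2⟩ := h ((i + l + 1 : ℕ) : ℤ)
    have e1 : a • p i + d • p (i + 1) = -(b • q i + c • q (i + 1)) := by
      rw [eq_neg_iff_add_eq_zero, ← h1]; abel
    have e2 : a' • p ((i + l + 1 : ℕ) : ℤ) + d' • p ((i + l + 1 : ℕ) + 1) =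
        -(b' • q ((i + l + 1 : ℕ) : ℤ) + c' • q ((i + l + 1 : ℕ) + 1)) := by
      rw [eq_neg_iff_add_eq_zero, ← h2]; abel
    have h3 : C (a • p i + d • p (i + 1))
        (a' • p ((i + l + 1 : ℕ) : ℤ) + d' • p ((i + l + 1 : ℕ) + 1)) = 0 := by
      have h11 := hp i (i + l + 1) (by omega) (by omega)
      have h12 := hp i (i + l + 1 + 1) (by omega) (by omega)
      have h22 := hp (i + 1) (i + l + 1 + 1) (by omega) (by omega)
      have h21 := hp (i + 1) (i + l + 1) (by omega) (by omega)
      push_cast at h11 h12 h22 h21 ⊢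
      simp [h11, h12, h22, h21]
    have g1 := ih l (by omega) (i + 1) (by omega)
    have g2 := ih (l + 1) (by omega) (i + 1) (by omega)
    have g3 := ih (l + 1) (by omega) i (by omega)
    rw [e1, e2] at h3
    have c1 : ((i + 1 + l : ℕ) : ℤ) = ((i + l + 1 : ℕ) : ℤ) := by push_cast; ring
    have c2 : ((i + 1 + (l + 1) : ℕ) : ℤ) = ((i + l + 1 : ℕ) : ℤ) + 1 := by push_cast; ring
    have c3 : ((i + (l + 1) : ℕ) : ℤ) = ((i + l + 1 : ℕ) : ℤ) := by push_cast; ring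
    have c4 : ((i + (l + 2) : ℕ) : ℤ) = ((i + l + 1 : ℕ) : ℤ) + 1 := by push_cast; ring
    rw [c1] at g1
    rw [c2] at g2
    rw [c3] at g3
    rw [c4]
    rw [Nat.cast_succ] at g1 g2
    simp only [map_neg, LinearMap.neg_apply, map_add, map_smul, LinearMap.add_apply,
      LinearMap.smul_apply, smul_eq_mul, g1, g2, g3] at h3
    have : (b * c') * C (q i) (q (((i + l + 1 : ℕ) : ℤ) + 1)) = 0 := by linarith
    simpa [hb, hc'] using this

theorem form_eq_zero_of_span {C : LinearMap.BilinForm ℝ Z} {ι : Type*} {b : ι → Z}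
    {A : Submodule ℝ Z} (hA : span ℝ (Set.range b) = A) (h : ∀ i k, C (b i) (b k) = 0) :
    ∀ x ∈ A, ∀ y ∈ A, C x y = 0 := by
  subst hA
  intro x hx y hy
  induction hx using span_induction with
  | zero => simp
  | add _ _ _ _ h1 h2 => simp [h1, h2]
  | smul _ _ _ h1 => simp [h1]
  | mem x hx =>
    obtain ⟨i, rfl⟩ := hx
    induction hy using span_induction with
    | zero => simp
    | add _ _ _ _ h1 h2 => simp [h1, h2]
    | smul _ _ _ h1 => simp [h1]
    | mem y hy =>
      obtain ⟨k, rfl⟩ := hy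
      exact h i k

namespace IsQNet

variable {m : ℤ → ℤ → Z} {V H : ℤ → Submodule ℝ Z}

theorem form_strip {p q : ℤ → Z} (h : ArePlanarStrip p q)
    {C : LinearMap.BilinForm ℝ Z} (hC : ∀ x y, C x y = C y x) {A B : Submodule ℝ Z}
    (hA : ∀ i, p i ∈ A) (hB : span ℝ (Set.range fun k : Fin 4 => q (0 + ((k : ℕ) : ℤ))) = B)
    (hCA : ∀ x ∈ A, ∀ y ∈ A, C x y = 0) (hq : ∀ i : ℕ, i ≤ 3 → C (q i) (q i) = 0) :
    ∀ x ∈ B, ∀ y ∈ B, C x y = 0 := by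
  refine form_eq_zero_of_span hB fun i k => ?_
  simp only [zero_add]
  wlog hik : (i : ℕ) ≤ k generalizing i k
  · rw [hC]
    exact this k i (by omega)
  have := h.form_eq_zero hC ((k : ℕ) - i) 3 (fun i k _ _ => hCA _ (hA _) _ (hA _)) hq i (by omega)
  rwa [Nat.add_sub_cancel' hik] at this

/-- A form that vanishes on `V 0`, and for which enough vertices are isotropic, vanishes on all
the `V i`. -/
theorem form_V (h : IsQNet m V H) {C : LinearMap.BilinForm ℝ Z} (hC : ∀ x y, C x y = C y x)
    (h0 : ∀ x ∈ V 0, ∀ y ∈ V 0, C x y = 0)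
    (hm : ∀ (i : ℤ) (j : ℕ), j ≤ 3 → C (m i j) (m i j) = 0) (i : ℤ) :
    ∀ x ∈ V i, ∀ y ∈ V i, C x y = 0 := by
  induction i using Int.induction_on with
  | zero => exact h0
  | succ i ih => exact form_strip (h.strip i) hC (h.mem_V i) (h.span_V _ 0) ih (hm _)
  | pred i ih =>
    have hs := (h.strip (-i - 1)).symm
    rw [sub_add_cancel] at hs
    exact form_strip hs hC (h.mem_V _) (h.span_V _ 0) ih (hm _)

/-- A quadric through a `Q`-net whose parameter lines lie in four-dimensional subspaces of a
seven-dimensional space belongs to a pencil spanned by quadrics that contain the two families of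
subspaces. -/
theorem exists_form [FiniteDimensional ℝ Z] (h : IsQNet m V H) (hZ : finrank ℝ Z = 7)
    (htop : V 0 ⊔ H 0 = ⊤) (L : LinearMap.BilinForm ℝ Z) (hL : ∀ x y, L x y = L y x)
    (hm : ∀ i j, L (m i j) (m i j) = 0) :
    ∃ B : LinearMap.BilinForm ℝ Z, (∀ x y, B x y = B y x) ∧
      (∀ i, ∀ x ∈ V i, ∀ y ∈ V i, B x y = 0) ∧ ∀ j, ∀ x ∈ H j, ∀ y ∈ H j, B x y = L x y := by
  -- `s i` is the only possible value of the functional `B (m i 0)`: zero on `V i` and equal to `L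
  -- (m i 0)` on `H 0`. The two prescriptions agree on the intersection, the line of `m i 0`,
  -- because that vertex is isotropic.
  have hs : ∀ i, ∃ s : Z →ₗ[ℝ] ℝ, (∀ x ∈ V i, s x = 0) ∧ ∀ x ∈ H 0, s x = L (m i 0) x := by
    intro i
    refine exists_linearMap_glue (V i) (H 0) 0 (L (m i 0)) fun x hx hx' => ?_
    have : x ∈ V i ⊓ H 0 := ⟨hx, hx'⟩
    rw [h.V_inf_H hZ htop, mem_span_singleton] at this
    obtain ⟨t, rfl⟩ := this
    simp [hm]
  choose s hsV hsH using hs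
  obtain ⟨S, hS⟩ := exists_linearMap_of_linearIndependent (h.swap.linearIndependent_V 0 0)
    fun k : Fin 4 => s (0 + ((k : ℕ) : ℤ))
  simp only [zero_add] at hS
  have hSH : ∀ x ∈ H 0, ∀ y ∈ H 0, S x y = L x y := by
    intro x hx y hy
    rw [← h.span_H 0 0] at hx
    induction hx using span_induction with
    | zero => simp
    | add _ _ _ _ h1 h2 => simp [h1, h2]
    | smul _ _ _ h1 => simp [h1]
    | mem x hx =>
      obtain ⟨k, rfl⟩ := hx
      simp only [zero_add]
      rw [hS, hsH _ _ hy]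
  have hS0 : S (m 0 0) = s 0 := by simpa using hS 0
  have hsurj : Function.Surjective (LinearMap.coprod (V 0).subtype (H 0).subtype) := by
    intro z
    have : z ∈ V 0 ⊔ H 0 := htop ▸ mem_top
    obtain ⟨v, hv, w, hw, rfl⟩ := mem_sup.1 this
    exact ⟨(⟨v, hv⟩, ⟨w, hw⟩), rfl⟩
  obtain ⟨σ, hσ⟩ := LinearMap.exists_rightInverse_of_surjective _ (LinearMap.range_eq_top.2 hsurj)
  obtain ⟨pV, hpV⟩ : ∃ pV : Z →ₗ[ℝ] Z, ∀ z, pV z = (σ z).1 :=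
    ⟨(V 0).subtype.comp ((LinearMap.fst ℝ _ _).comp σ), fun z => rfl⟩
  obtain ⟨pH, hpH⟩ : ∃ pH : Z →ₗ[ℝ] Z, ∀ z, pH z = (σ z).2 :=
    ⟨(H 0).subtype.comp ((LinearMap.snd ℝ _ _).comp σ), fun z => rfl⟩
  have hpVm : ∀ z, pV z ∈ V 0 := fun z => by rw [hpV]; exact (σ z).1.2
  have hpHm : ∀ z, pH z ∈ H 0 := fun z => by rw [hpH]; exact (σ z).2.2
  have hsum : ∀ z, pV z + pH z = z := fun z => by
    rw [hpV, hpH]; exact LinearMap.congr_fun hσ z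
  have hVt : ∀ z ∈ V 0, ∃ t : ℝ, pH z = t • m 0 0 := by
    intro z hz
    have : pH z ∈ V 0 ⊓ H 0 :=
      ⟨by rw [eq_sub_iff_add_eq'.2 (hsum z)]; exact sub_mem hz (hpVm z), hpHm z⟩
    rw [h.V_inf_H hZ htop, mem_span_singleton] at this
    obtain ⟨t, ht⟩ := this
    exact ⟨t, ht.symm⟩
  have hHt : ∀ z ∈ H 0, ∃ t : ℝ, pV z = t • m 0 0 := by
    intro z hz
    have : pV z ∈ V 0 ⊓ H 0 :=
      ⟨hpVm z, by rw [eq_sub_iff_add_eq.2 (hsum z)]; exact sub_mem hz (hpHm z)⟩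
    rw [h.V_inf_H hZ htop, mem_span_singleton] at this
    obtain ⟨t, ht⟩ := this
    exact ⟨t, ht.symm⟩
  -- `B` is to vanish on `V 0`, to equal `L` on `H 0`, and to pair `H 0` with `V 0` through `S`. The
  -- splitting `pV + pH` is not canonical because `V 0` and `H 0` share the line of `m 0 0`, but
  -- there all prescriptions agree.
  let P : LinearMap.BilinForm ℝ Z := S.compl₁₂ pH pV
  let B : LinearMap.BilinForm ℝ Z := P + P.flip + L.compl₁₂ pH pH
  have hB : ∀ x y, B x y = S (pH x) (pV y) + S (pH y) (pV x) + L (pH x) (pH y) := fun x y => rfl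
  have hBsymm : ∀ x y, B x y = B y x := fun x y => by rw [hB, hB, hL (pH x)]; ring
  have hBV0 : ∀ x ∈ V 0, ∀ y ∈ V 0, B x y = 0 := by
    intro x hx y hy
    obtain ⟨t, ht⟩ := hVt x hx
    obtain ⟨u, hu⟩ := hVt y hy
    rw [hB, ht, hu]
    simp [hS0, hm, hsV 0 _ (hpVm _)]
  have hBs : ∀ (k : ℕ), k ≤ 3 → ∀ z, B (m k 0) z = s k z := by
    intro k hk z
    have hSk : S (m k 0) = s k := hS ⟨k, by omega⟩
    obtain ⟨t, ht⟩ := hHt (m k 0) (h.mem_H _ _)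
    have h2 : pH (m k 0) = m k 0 - t • m 0 0 := by rw [← ht, eq_sub_iff_add_eq'.2 (hsum _)]
    rw [hB, ht, h2]
    conv_rhs => rw [← hsum z, map_add, hsH _ _ (hpHm z)]
    simp only [map_sub, map_smul, LinearMap.sub_apply, LinearMap.smul_apply, smul_eq_mul, hSk, hS0,
      hsV 0 _ (hpVm _), hSH _ (hpHm z) _ (h.mem_H 0 0), hL (pH z)]
    ring
  -- `V (k + 1)` is generated by `m (k + 1) 0`, whose functional `s (k + 1)` vanishes on it, and by
  -- a part of `V k`.
  have hBV : ∀ k : ℕ, k ≤ 3 → ∀ x ∈ V k, ∀ y ∈ V k, B x y = 0 := by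
    intro k hk
    induction k with
    | zero => exact hBV0
    | succ k ih =>
      intro x hx y hy
      obtain ⟨x1, hx1, x2, hx2, rfl⟩ := mem_sup.1 (h.V_succ_le_sup k 0 (by exact_mod_cast hx))
      obtain ⟨y1, hy1, y2, hy2, rfl⟩ := mem_sup.1 (h.V_succ_le_sup k 0 (by exact_mod_cast hy))
      obtain ⟨t, rfl⟩ := mem_span_singleton.1 hx1
      obtain ⟨u, rfl⟩ := mem_span_singleton.1 hy1
      have hb : ∀ z ∈ V ((k : ℤ) + 1), B (m (k + 1) 0) z = 0 := by
        intro z hz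
        have := hBs (k + 1) hk z
        push_cast at this
        rw [this, hsV _ _ hz]
      have hb1 := hb _ (h.mem_V (k + 1) 0)
      have hb2 := hb _ hx2.2
      have hb3 := hb _ hy2.2
      rw [hBsymm] at hb2
      simp [hb1, hb2, hb3, ih (by omega) _ hx2.1 _ hy2.1]
  have hCsymm : ∀ x y, (L - B) x y = (L - B) y x := fun x y => by
    simp [hL x y, hBsymm x y]
  -- `L - B` vanishes on `H 0` and at the vertices in the columns 0 to 3. These four vertices span
  -- each `H j`, so the vanishing propagates across all strips.
  have hCH : ∀ j, ∀ x ∈ H j, ∀ y ∈ H j, (L - B) x y = 0 := by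
    refine h.swap.form_V hCsymm ?_ ?_
    · refine form_eq_zero_of_span (h.span_H 0 0) fun i k => ?_
      simp only [zero_add, LinearMap.sub_apply]
      rw [hBs _ (by omega), hsH _ _ (h.mem_H _ _), sub_self]
    · intro j i hi
      simp [hm, hBV i hi _ (h.mem_V i j) _ (h.mem_V i j)]
  have hCH' : ∀ j, ∀ x ∈ H j, ∀ y ∈ H j, B x y = L x y := fun j x hx y hy =>
    (sub_eq_zero.1 (hCH j x hx y hy)).symm
  -- Now `B = L` on every `H j`, so `B` vanishes at all vertices and the propagation can be run in
  -- the other direction, from `V 0`.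
  refine ⟨B, hBsymm, h.form_V hBsymm hBV0 fun i j _ => ?_, hCH'⟩
  rw [hCH' j _ (h.mem_H _ _) _ (h.mem_H _ _), hm]

end IsQNet

end DarbouxNet

/-! ### Lifting a Q-net to a space of dimension 7. -/

namespace DarbouxNet

open Submodule Module

universe u

theorem exists_int_sequence {α : Type*} (P : ℤ → α → Prop) (R : ℤ → α → α → Prop) (x₀ : α)
    (h₀ : P 0 x₀) (hs : ∀ i x, ∃ y, P (i + 1) y ∧ R i x y) (hp : ∀ i y, ∃ x, P i x ∧ R i x y) :
    ∃ f : ℤ → α, f 0 = x₀ ∧ ∀ i, P i (f i) ∧ R i (f i) (f (i + 1)) := by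
  choose F hF using hs
  choose G hG using hp
  let fw : ℕ → α := fun k => Nat.rec x₀ (fun k x => F k x) k
  let bw : ℕ → α := fun k => Nat.rec x₀ (fun k y => G (-k - 1) y) k
  let f : ℤ → α := fun i => Int.casesOn i fw fun k => bw (k + 1)
  have hf : ∀ k : ℕ, f k = fw k := fun k => rfl
  have hb : ∀ k : ℕ, f (-k) = bw k := by
    rintro (_ | k)
    · rfl
    · rfl
  have hRf : ∀ k : ℕ, P (k + 1) (f (k + 1)) ∧ R k (f k) (f (k + 1)) := by
    intro k
    have e : f (k + 1) = F k (f k) := hf (k + 1)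
    rw [e]
    exact hF _ _
  have hRb : ∀ k : ℕ, P (-k - 1) (f (-k - 1)) ∧ R (-k - 1) (f (-k - 1)) (f (-k)) := by
    intro k
    have e : f (-k - 1) = G (-k - 1) (f (-k)) := by
      rw [hb k, show (-k - 1 : ℤ) = -((k + 1 : ℕ) : ℤ) by push_cast; ring, hb]
      change G (-k - 1) _ = _
      congr 1
      push_cast; ring
    rw [e]
    exact hG _ _
  refine ⟨f, rfl, fun i => ?_⟩
  obtain ⟨k, rfl | rfl⟩ := i.eq_nat_or_neg
  · refine ⟨?_, (hRf k).2⟩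
    rcases k with _ | k
    · exact h₀
    · exact_mod_cast (hRf k).1
  · rcases k with _ | k
    · exact ⟨h₀, (hRf 0).2⟩
    · have := hRb k
      rw [show (-((k + 1 : ℕ) : ℤ)) = -k - 1 by push_cast; ring, sub_add_cancel]
      exact this

variable {Z : Type u} {Z' : Type*} [AddCommGroup Z] [Module ℝ Z] [AddCommGroup Z'] [Module ℝ Z']

/-- Linear maps on the members of a family of subspaces, consecutive ones of which agree on the
intersection of their domains. -/
def AreCompatible (V : ℤ → Submodule ℝ Z) (F : ℤ → Z →ₗ[ℝ] Z') : Prop :=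
  ∀ i, ∀ x ∈ V i, x ∈ V (i + 1) → F i x = F (i + 1) x

/-- The subspaces `V' i` are isomorphic copies of the `V i`. -/
structure IsFamilyLift (π : Z' →ₗ[ℝ] Z) (V : ℤ → Submodule ℝ Z) (V' : ℤ → Submodule ℝ Z') :
    Prop where
  map : ∀ i, (V' i).map π = V i
  inj : ∀ i, ∀ x ∈ V' i, π x = 0 → x = 0

/-- Three vertices of a quadrilateral determine the fourth, so values on the two axes determine the
whole net; used to identify two lifts of a vertex. -/
theorem eq_zero_of_quad {D : ℤ → ℤ → Z} (hi : ∀ i, D i 0 = 0) (hj : ∀ j, D 0 j = 0)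
    (hD : ∀ i j, ∃ a b c d : ℝ, a ≠ 0 ∧ b ≠ 0 ∧ c ≠ 0 ∧ d ≠ 0 ∧
      a • D i j + b • D (i + 1) j + c • D (i + 1) (j + 1) + d • D i (j + 1) = 0) (i j : ℤ) :
    D i j = 0 := by
  induction j using Int.induction_on generalizing i with
  | zero => exact hi i
  | succ j ihj =>
    induction i using Int.induction_on with
    | zero => exact hj _
    | succ i ihi =>
      obtain ⟨a, b, c, d, ha, hb, hc, hd, h⟩ := hD i j
      simpa [ihj, ihi, hc] using h
    | pred i ihi =>
      obtain ⟨a, b, c, d, ha, hb, hc, hd, h⟩ := hD (-i - 1) j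
      rw [sub_add_cancel] at h
      simpa [ihj, ihi, hd] using h
  | pred j ihj =>
    induction i using Int.induction_on with
    | zero => exact hj _
    | succ i ihi =>
      obtain ⟨a, b, c, d, ha, hb, hc, hd, h⟩ := hD i (-j - 1)
      rw [sub_add_cancel] at h
      simpa [ihj, ihi, hb] using h
    | pred i ihi =>
      obtain ⟨a, b, c, d, ha, hb, hc, hd, h⟩ := hD (-i - 1) (-j - 1)
      rw [sub_add_cancel, sub_add_cancel] at h
      simpa [ihj, ihi, ha] using h

namespace IsQNet

variable {m : ℤ → ℤ → Z} {V H : ℤ → Submodule ℝ Z}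

theorem exists_glue_vertex {v : Z} {A : Submodule ℝ Z} (hv : v ∉ A) (f g : Z →ₗ[ℝ] Z') :
    ∃ s : Z →ₗ[ℝ] Z', s v = g v ∧ ∀ x ∈ A, s x = f x := by
  obtain ⟨s, h1, h2⟩ := exists_linearMap_glue A (span ℝ {v}) f g fun x hx hx' => by
    obtain ⟨t, rfl⟩ := mem_span_singleton.1 hx'
    have : t = 0 := by
      by_contra ht
      exact hv (mem_of_smul_mem' ht hx)
    simp [this]
  exact ⟨s, h2 _ (mem_span_singleton_self _), h1⟩

/-- `V (i + 1)` is the sum of `V i ⊓ V (i + 1)`, where the map is forced, and the line of `m (i + 1)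
0`, where it is free. Hence a map on `V 0` and values along the row `j = 0` extend step by step in
both directions. -/
theorem exists_compatible (h : IsQNet m V H) (f g : Z →ₗ[ℝ] Z') (hfg : f (m 0 0) = g (m 0 0)) :
    ∃ F : ℤ → Z →ₗ[ℝ] Z', F 0 = f ∧ (∀ i, F i (m i 0) = g (m i 0)) ∧ AreCompatible V F := by
  obtain ⟨F, h0, hF⟩ := exists_int_sequence (fun i (F : Z →ₗ[ℝ] Z') => F (m i 0) = g (m i 0))
    (fun i F F' => ∀ x ∈ V i, x ∈ V (i + 1) → F x = F' x) f hfg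
    (fun i F => by
      obtain ⟨s, h1, h2⟩ := exists_glue_vertex (h.notMem_V_pred i 0) F g
      exact ⟨s, h1, fun x hx _ => (h2 x hx).symm⟩)
    (fun i F => by
      obtain ⟨s, h1, h2⟩ := exists_glue_vertex (h.notMem_V_succ i 0) F g
      exact ⟨s, h1, fun x _ hx => h2 x hx⟩)
  exact ⟨F, h0, fun i => (hF i).1, fun i => (hF i).2⟩

/-- The point `a • m i j + d • m i (j + 1)` lies in both neighbouring spaces, where the two maps
agree. -/
theorem map_quad (h : IsQNet m V H) {F : ℤ → Z →ₗ[ℝ] Z'} (hF : AreCompatible V F) {i j : ℤ}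
    {a b c d : ℝ}
    (e : a • m i j + b • m (i + 1) j + c • m (i + 1) (j + 1) + d • m i (j + 1) = 0) :
    a • F i (m i j) + b • F (i + 1) (m (i + 1) j) + c • F (i + 1) (m (i + 1) (j + 1)) +
      d • F i (m i (j + 1)) = 0 := by
  have e' : a • m i j + d • m i (j + 1) = -(b • m (i + 1) j + c • m (i + 1) (j + 1)) := by
    rw [eq_neg_iff_add_eq_zero, ← e]; abel
  have h1 : a • m i j + d • m i (j + 1) ∈ V i :=
    add_mem (smul_mem _ _ (h.mem_V _ _)) (smul_mem _ _ (h.mem_V _ _))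
  have h2 : a • m i j + d • m i (j + 1) ∈ V (i + 1) := by
    rw [e']
    exact neg_mem (add_mem (smul_mem _ _ (h.mem_V _ _)) (smul_mem _ _ (h.mem_V _ _)))
  have h3 := hF i _ h1 h2
  conv_rhs at h3 => rw [e']
  simp only [map_add, map_smul, map_neg] at h3
  rw [eq_neg_iff_add_eq_zero] at h3
  rw [← h3]; abel

theorem isFamilyLift (h : IsQNet m V H) {F : ℤ → Z →ₗ[ℝ] Z'} (hF : AreCompatible V F)
    {π : Z' →ₗ[ℝ] Z} (h0 : ∀ x ∈ V 0, π (F 0 x) = x) (hm : ∀ i, π (F i (m i 0)) = m i 0) :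
    (∀ i, ∀ x ∈ V i, π (F i x) = x) ∧ IsFamilyLift π V fun i => (V i).map (F i) := by
  have key : ∀ i, ∀ x ∈ V i, π (F i x) = x := by
    intro i
    induction i using Int.induction_on with
    | zero => exact h0
    | succ i ih =>
      intro x hx
      obtain ⟨y, hy, w, hw, rfl⟩ := mem_sup.1 (h.V_succ_le_sup i 0 hx)
      obtain ⟨t, rfl⟩ := mem_span_singleton.1 hy
      rw [map_add, map_add, map_smul, map_smul, hm, ← hF i w hw.1 hw.2, ih w hw.1]
    | pred i ih =>
      intro x hx
      have hle := h.V_le_sup_succ (-i - 1) 0 hx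
      have hFi := hF (-i - 1)
      rw [sub_add_cancel] at hle hFi
      obtain ⟨y, hy, w, hw, rfl⟩ := mem_sup.1 hle
      obtain ⟨t, rfl⟩ := mem_span_singleton.1 hy
      rw [map_add, map_add, map_smul, map_smul, hm, hFi w hw.1 hw.2, ih w hw.2]
  refine ⟨key, fun i => ?_, fun i => ?_⟩
  · ext x
    constructor
    · rintro ⟨_, ⟨x, hx, rfl⟩, rfl⟩
      rw [key i x hx]
      exact hx
    · exact fun hx => ⟨F i x, ⟨x, hx, rfl⟩, key i x hx⟩
  · rintro _ ⟨x, hx, rfl⟩ hx0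
    rw [key i x hx] at hx0
    rw [hx0, map_zero]

theorem finrank_map_of_leftInverse {A : Submodule ℝ Z} {f : Z →ₗ[ℝ] Z'} {π : Z' →ₗ[ℝ] Z}
    (h : ∀ x ∈ A, π (f x) = x) : finrank ℝ (A.map f) = finrank ℝ A := by
  rw [← LinearMap.range_domRestrict]
  refine LinearMap.finrank_range_of_inj fun x y hxy => Subtype.ext ?_
  rw [← h x x.2, ← h y y.2]
  exact congrArg π hxy

theorem exists_lift_of_maps (h : IsQNet m V H) (π : Z' →ₗ[ℝ] Z) (f g : Z →ₗ[ℝ] Z')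
    (hfg : f (m 0 0) = g (m 0 0)) (hf : ∀ x ∈ V 0, π (f x) = x) (hg : ∀ x ∈ H 0, π (g x) = x) :
    ∃ (m' : ℤ → ℤ → Z') (V' H' : ℤ → Submodule ℝ Z'), IsQNet m' V' H' ∧
      V' 0 = (V 0).map f ∧ H' 0 = (H 0).map g ∧ (∀ i j, π (m' i j) = m i j) ∧
      IsFamilyLift π V V' ∧ IsFamilyLift π H H' := by
  obtain ⟨F, hF0, hFm, hF⟩ := h.exists_compatible f g hfg
  obtain ⟨G, hG0, hGm, hG⟩ := h.swap.exists_compatible g f hfg.symm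
  -- A vertex has a lift through `V i` and a lift through `H j`. Both satisfy the quadrilateral
  -- relations of the net and they agree on the axes.
  have hFG : ∀ i j, F i (m i j) - G j (m i j) = 0 := by
    refine eq_zero_of_quad (fun i => ?_) (fun j => ?_) fun i j => ?_
    · rw [hG0, hFm, sub_self]
    · rw [hF0, hGm, sub_self]
    · obtain ⟨a, b, c, d, ha, hb, hc, hd, e⟩ := h.quad i j
      refine ⟨a, b, c, d, ha, hb, hc, hd, ?_⟩
      have h1 := h.map_quad hF e
      have h2 := h.swap.map_quad hG (i := j) (j := i) (a := a) (b := d) (c := c) (d := b)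
        (by rw [← e]; abel)
      rw [← sub_eq_zero.2 (h1.trans h2.symm)]
      simp only [smul_sub]
      abel
  have hFG' : ∀ i j, F i (m i j) = G j (m i j) := fun i j => sub_eq_zero.1 (hFG i j)
  obtain ⟨hFπ, hFV⟩ := h.isFamilyLift hF (π := π) (by rwa [hF0]) fun i => by
    rw [hFm, hg _ (h.mem_H _ _)]
  obtain ⟨hGπ, hGH⟩ := h.swap.isFamilyLift hG (π := π) (by rwa [hG0]) fun j => by
    rw [hGm, hf _ (h.mem_V _ _)]
  refine ⟨fun i j => F i (m i j), fun i => (V i).map (F i), fun j => (H j).map (G j),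
    ⟨fun i j => ?_, fun i j => ?_, fun i => ?_, fun j => ?_, fun i hi => ?_, fun j hj => ?_,
      fun i j => ?_⟩, by simp only [hF0], by simp only [hG0], fun i j => hFπ i _ (h.mem_V i j),
      hFV, hGH⟩
  · rw [← h.span_V i j, map_span, ← Set.range_comp]
    rfl
  · rw [← h.span_H i j, map_span, ← Set.range_comp]
    simp only [hFG']
    rfl
  · rw [finrank_map_of_leftInverse (hFπ i), h.finrank_V]
  · rw [finrank_map_of_leftInverse (hGπ j), h.finrank_H]
  · exact h.V_ne i ((hFV.map i).symm.trans ((congrArg _ hi).trans (hFV.map (i + 1))))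
  · exact h.H_ne j ((hGH.map j).symm.trans ((congrArg _ hj).trans (hGH.map (j + 1))))
  · obtain ⟨a, b, c, d, ha, hb, hc, hd, e⟩ := h.quad i j
    exact ⟨a, b, c, d, ha, hb, hc, hd, h.map_quad hF e⟩

/-- A `Q`-net whose parameter lines lie in four-dimensional subspaces is a projection of such a
net in a space of dimension seven. -/
theorem exists_lift (h : IsQNet m V H) (htop : V 0 ⊔ H 0 = ⊤) :
    ∃ (Z' : Type u) (_ : AddCommGroup Z') (_ : Module ℝ Z') (_ : FiniteDimensional ℝ Z')
      (π : Z' →ₗ[ℝ] Z) (m' : ℤ → ℤ → Z') (V' H' : ℤ → Submodule ℝ Z'),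
      finrank ℝ Z' = 7 ∧ Function.Surjective π ∧ IsQNet m' V' H' ∧ V' 0 ⊔ H' 0 = ⊤ ∧
      (∀ i j, π (m' i j) = m i j) ∧ IsFamilyLift π V V' ∧ IsFamilyLift π H H' := by
  have := h.finiteDimensional_V 0
  have := h.swap.finiteDimensional_V 0
  -- The quotient by `e` glues `V 0` and `H 0` along the common vertex `m 0 0` only, which gives
  -- dimension 4 + 4 - 1.
  let e : V 0 × H 0 := (⟨m 0 0, h.mem_V 0 0⟩, -⟨m 0 0, h.mem_H 0 0⟩)
  have he : e ≠ 0 := fun h0 => h.ne_zero 0 0 (congrArg (fun x : V 0 × H 0 => (x.1 : Z)) h0)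
  let K : Submodule ℝ (V 0 × H 0) := span ℝ {e}
  let π : ((V 0 × H 0) ⧸ K) →ₗ[ℝ] Z := K.liftQ (LinearMap.coprod (V 0).subtype (H 0).subtype) (by
    rw [span_singleton_le_iff_mem, LinearMap.mem_ker]
    simp [e])
  obtain ⟨f, hf⟩ := LinearMap.exists_extend (p := V 0) (K.mkQ.comp (LinearMap.inl ℝ _ _))
  obtain ⟨g, hg⟩ := LinearMap.exists_extend (p := H 0) (K.mkQ.comp (LinearMap.inr ℝ _ _))
  have hf' : ∀ x : V 0, f x = K.mkQ (x, 0) := fun x => LinearMap.congr_fun hf x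
  have hg' : ∀ x : H 0, g x = K.mkQ (0, x) := fun x => LinearMap.congr_fun hg x
  obtain ⟨m', V', H', hn, hV, hH, hm, hVl, hHl⟩ := h.exists_lift_of_maps π f g
    (by
      have h1 := hf' ⟨m 0 0, h.mem_V 0 0⟩
      have h2 := hg' ⟨m 0 0, h.mem_H 0 0⟩
      simp only at h1 h2
      rw [h1, h2, ← sub_eq_zero, ← map_sub, mkQ_apply, Quotient.mk_eq_zero]
      convert mem_span_singleton_self e using 1
      simp [e])
    (fun x hx => by
      have h1 := hf' ⟨x, hx⟩
      simp only at h1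
      simp [h1, π])
    (fun x hx => by
      have h1 := hg' ⟨x, hx⟩
      simp only at h1
      simp [h1, π])
  refine ⟨_, inferInstance, inferInstance, inferInstance, π, m', V', H', ?_, ?_, hn, ?_, hm, hVl,
    hHl⟩
  · have := K.finrank_quotient_add_finrank
    rw [finrank_prod, h.finrank_V, h.finrank_H, finrank_span_singleton he] at this
    omega
  · rw [← LinearMap.range_eq_top, eq_top_iff, ← htop]
    exact sup_le ((hVl.map 0).symm.le.trans LinearMap.map_le_range)
      ((hHl.map 0).symm.le.trans LinearMap.map_le_range)
  · rw [hV, hH, eq_top_iff]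
    rintro z -
    obtain ⟨⟨x, y⟩, rfl⟩ := K.mkQ_surjective z
    refine mem_sup.2 ⟨f x, ⟨x, x.2, rfl⟩, g y, ⟨y, y.2, rfl⟩, ?_⟩
    rw [hf', hg', ← map_add]
    simp

end IsQNet

end DarbouxNet

/-! ### The Lorentz product and the Q-net of a circular net. -/

namespace DarbouxNet

open Submodule Module

variable {n : ℕ}

theorem form_eq_toBilin' (A : Matrix (Fin (n + 2)) (Fin (n + 2)) ℝ) (x y : Amb n) :
    form A x y = Matrix.toBilin' A x y := (Matrix.toBilin'_apply' A x y).symm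

/-- The Lorentz product as a bilinear form. -/
noncomputable def lorentzForm (n : ℕ) : LinearMap.BilinForm ℝ (Amb n) :=
  Matrix.toBilin' (lorentz n)

theorem form_lorentz (x y : Amb n) : form (lorentz n) x y = lorentzForm n x y :=
  form_eq_toBilin' _ _ _

theorem form_comm {A : Matrix (Fin (n + 2)) (Fin (n + 2)) ℝ} (hA : A.IsSymm) (x y : Amb n) :
    form A x y = form A y x := by
  rw [form, form, Matrix.dotProduct_mulVec, ← Matrix.mulVec_transpose, hA, dotProduct_comm]

theorem lorentz_isSymm : (lorentz n).IsSymm := Matrix.isSymm_diagonal _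

theorem lorentzForm_comm (x y : Amb n) : lorentzForm n x y = lorentzForm n y x := by
  rw [← form_lorentz, form_comm lorentz_isSymm, form_lorentz]

theorem lorentzForm_apply (x y : Amb n) : lorentzForm n x y =
    ∑ i : Fin (n + 1), x i.castSucc * y i.castSucc - x (Fin.last _) * y (Fin.last _) := by
  rw [← form_lorentz, form, dotProduct, Fin.sum_univ_castSucc]
  simp [lorentz, Matrix.mulVec_diagonal, Fin.castSucc_ne_last, sub_eq_add_neg]

theorem lorentzForm_nondegenerate {x : Amb n} (h : ∀ y, lorentzForm n x y = 0) : x = 0 := by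
  have h1 : (lorentzForm n).Nondegenerate :=
    LinearMap.BilinForm.nondegenerate_toBilin'_of_det_ne_zero' _ (by
      rw [lorentz, Matrix.det_diagonal, Finset.prod_ne_zero_iff]
      intro i _
      split_ifs <;> norm_num)
  exact h1.1 x h

theorem eq_zero_of_null_of_last {x : Amb n} (h : lorentzForm n x x = 0)
    (h0 : x (Fin.last _) = 0) : x = 0 := by
  rw [lorentzForm_apply, h0, mul_zero, sub_zero,
    Finset.sum_eq_zero_iff_of_nonneg fun _ _ => mul_self_nonneg _] at h
  funext i
  induction i using Fin.lastCases with
  | last => exact h0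
  | cast i => exact mul_self_eq_zero.1 (h i (Finset.mem_univ _))

/-- The difference of the two sides is a null vector with vanishing last coordinate, and the product
is positive definite on that hyperplane. -/
theorem smul_eq_smul_of_null {x y : Amb n} (hx : lorentzForm n x x = 0)
    (hy : lorentzForm n y y = 0) (hxy : lorentzForm n x y = 0) :
    y (Fin.last _) • x = x (Fin.last _) • y := by
  rw [← sub_eq_zero]
  apply eq_zero_of_null_of_last
  · simp [hx, hy, hxy, lorentzForm_comm y x]
  · simp [mul_comm]

theorem last_ne_zero_of_null {x : Amb n} (h : lorentzForm n x x = 0) (h0 : x ≠ 0) :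
    x (Fin.last _) ≠ 0 := fun h1 => h0 (eq_zero_of_null_of_last h h1)

theorem finrank_le_one_of_isotropic {A : Submodule ℝ (Amb n)}
    (hA : ∀ x ∈ A, ∀ y ∈ A, lorentzForm n x y = 0) : finrank ℝ A ≤ 1 := by
  by_cases h : ∃ v ∈ A, v ≠ 0
  · obtain ⟨v, hv, hv0⟩ := h
    have hl := last_ne_zero_of_null (hA v hv v hv) hv0
    refine finrank_le_one (⟨v, hv⟩ : A) fun w => ⟨(v (Fin.last _))⁻¹ * w.1 (Fin.last _), ?_⟩
    apply Subtype.ext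
    change ((v (Fin.last _))⁻¹ * w.1 (Fin.last _)) • v = w.1
    rw [mul_smul, smul_eq_smul_of_null (hA v hv v hv) (hA w w.2 w w.2) (hA v hv w w.2), smul_smul,
      inv_mul_cancel₀ hl, one_smul]
  · push Not at h
    rw [(Submodule.eq_bot_iff A).2 h, finrank_bot]
    exact zero_le_one

theorem rep_mem_of_mem_sphereOf {U : Submodule ℝ (Amb n)} {p : ProjSpace n}
    (h : p ∈ sphereOf n U) : p.rep ∈ U := by
  have := h.1
  rwa [Set.mem_ofPred_eq, Projectivization.submodule_eq, span_singleton_le_iff_mem] at this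

theorem mem_mobiusQuadric {p : ProjSpace n} :
    p ∈ mobiusQuadric n ↔ lorentzForm n p.rep p.rep = 0 := by
  rw [← form_lorentz]
  rfl

theorem lorentzForm_rep_ne_zero {p q : ProjSpace n} (hp : p ∈ mobiusQuadric n)
    (hq : q ∈ mobiusQuadric n) (h : p ≠ q) : lorentzForm n p.rep q.rep ≠ 0 := by
  intro h0
  rw [mem_mobiusQuadric] at hp hq
  have hp' := last_ne_zero_of_null hp p.rep_nonzero
  have e := smul_eq_smul_of_null hp hq h0
  apply h
  rw [← p.mk_rep, ← q.mk_rep, Projectivization.mk_eq_mk_iff']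
  have hq' := last_ne_zero_of_null hq q.rep_nonzero
  refine ⟨(q.rep (Fin.last _))⁻¹ * p.rep (Fin.last _), ?_⟩
  rw [mul_smul, ← e, smul_smul, inv_mul_cancel₀ hq', one_smul]

/-- The Gram determinant of three null vectors is twice the product of their mutual products;
geometrically, no line meets the Möbius quadric in three distinct points. -/
theorem coeff_eq_zero_of_null {p q r : Amb n} (hp : lorentzForm n p p = 0)
    (hq : lorentzForm n q q = 0) (hr : lorentzForm n r r = 0) (hpq : lorentzForm n p q ≠ 0)
    (hpr : lorentzForm n p r ≠ 0) (hqr : lorentzForm n q r ≠ 0) {a b c : ℝ}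
    (h : a • p + b • q + c • r = 0) : a = 0 ∧ b = 0 ∧ c = 0 := by
  have h1 := congrArg (lorentzForm n p) h
  have h2 := congrArg (lorentzForm n q) h
  have h3 := congrArg (lorentzForm n r) h
  simp only [map_add, map_smul, smul_eq_mul, map_zero, hp, hq, hr, lorentzForm_comm q p,
    lorentzForm_comm r p, lorentzForm_comm r q] at h1 h2 h3
  have ha : (2 * lorentzForm n p q * lorentzForm n p r) * a = 0 := by
    linear_combination (-lorentzForm n q r) * h1 + lorentzForm n p r * h2 + lorentzForm n p q * h3
  have ha' : a = 0 := by simpa [hpq, hpr] using ha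
  subst ha'
  exact ⟨rfl, by simpa [hqr] using h3, by simpa [hqr] using h2⟩

/-- The rank bound gives a nontrivial relation. A zero coefficient would leave a relation between
three pairwise non-orthogonal null vectors. -/
theorem exists_quad_relation {p q r s : Amb n} (hp : lorentzForm n p p = 0)
    (hq : lorentzForm n q q = 0) (hr : lorentzForm n r r = 0) (hs : lorentzForm n s s = 0)
    (hpq : lorentzForm n p q ≠ 0) (hpr : lorentzForm n p r ≠ 0) (hps : lorentzForm n p s ≠ 0)
    (hqr : lorentzForm n q r ≠ 0) (hqs : lorentzForm n q s ≠ 0) (hrs : lorentzForm n r s ≠ 0)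
    (h : finrank ℝ (span ℝ {p} ⊔ span ℝ {q} ⊔ span ℝ {r} ⊔ span ℝ {s} : Submodule ℝ (Amb n)) ≤ 3) :
    ∃ a b c d : ℝ, a ≠ 0 ∧ b ≠ 0 ∧ c ≠ 0 ∧ d ≠ 0 ∧ a • p + b • q + c • r + d • s = 0 := by
  have hli : ¬ LinearIndependent ℝ ![p, q, r, s] := by
    intro hli
    have h1 := finrank_span_eq_card hli
    have e : span ℝ (Set.range ![p, q, r, s]) =
        span ℝ {p} ⊔ span ℝ {q} ⊔ span ℝ {r} ⊔ span ℝ {s} := by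
      simp [Matrix.range_cons, span_insert, sup_assoc, sup_comm]
    rw [e] at h1
    simp at h1
    omega
  rw [Fintype.not_linearIndependent_iff] at hli
  obtain ⟨g, hg, k, hk⟩ := hli
  simp only [Fin.sum_univ_four, Matrix.cons_val] at hg
  have key : ∀ i, g i ≠ 0 := by
    intro i hi
    apply hk
    fin_cases i <;> simp only [Fin.mk_zero, Fin.mk_one, Fin.reduceFinMk] at hi <;>
      rw [hi, zero_smul] at hg
    · obtain ⟨h1, h2, h3⟩ := coeff_eq_zero_of_null hq hr hs hqr hqs hrs (by rw [← hg]; abel)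
      fin_cases k <;> assumption
    · obtain ⟨h1, h2, h3⟩ := coeff_eq_zero_of_null hp hr hs hpr hps hrs (by rw [← hg]; abel)
      fin_cases k <;> assumption
    · obtain ⟨h1, h2, h3⟩ := coeff_eq_zero_of_null hp hq hs hpq hps hqs (by rw [← hg]; abel)
      fin_cases k <;> assumption
    · obtain ⟨h1, h2, h3⟩ := coeff_eq_zero_of_null hp hq hr hpq hpr hqr (by rw [← hg]; abel)
      fin_cases k <;> assumption
  exact ⟨_, _, _, _, key 0, key 1, key 2, key 3, hg⟩

section Net

variable {M : ℤ → ℤ → ProjSpace n} {V H : ℤ → Submodule ℝ (Amb n)}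

theorem span_rep_eq {p : Fin 4 → ProjSpace n} {U : Submodule ℝ (Amb n)} (hU : finrank ℝ U = 4)
    (hp : ∀ k, p k ∈ sphereOf n U)
    (h : finrank ℝ (⨆ k, (p k).submodule : Submodule ℝ (Amb n)) = 4) :
    span ℝ (Set.range fun k => (p k).rep) = U := by
  have e : span ℝ (Set.range fun k => (p k).rep) = ⨆ k, (p k).submodule := by
    rw [span_range_eq_iSup]
    simp only [Projectivization.submodule_eq]
  apply eq_of_le_of_finrank_eq
  · rw [span_le]
    rintro _ ⟨k, rfl⟩
    exact rep_mem_of_mem_sphereOf (hp k)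
  · rw [e, h, hU]

theorem isQNet_of_isCircularNet (hM : IsCircularNet n M)
    (hV : ∀ i, finrank ℝ (V i) = 4) (hH : ∀ j, finrank ℝ (H j) = 4)
    (hMV : ∀ i j, M i j ∈ sphereOf n (V i)) (hMH : ∀ i j, M i j ∈ sphereOf n (H j))
    (hgen : NetInGeneralPosition n M V H) : IsQNet (fun i j => (M i j).rep) V H where
  span_V i j := span_rep_eq (hV i) (fun _ => hMV _ _) (hgen.col_span i j)
  span_H i j := span_rep_eq (hH j) (fun _ => hMH _ _) (hgen.row_span i j)
  finrank_V := hV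
  finrank_H := hH
  V_ne := hgen.adjacent_V
  H_ne := hgen.adjacent_H
  quad i j := by
    have hn : ∀ i j, lorentzForm n (M i j).rep (M i j).rep = 0 := fun i j =>
      mem_mobiusQuadric.1 (hM.mem_mobius i j)
    have hd : ∀ {i j i' j'}, M i j ≠ M i' j' → lorentzForm n (M i j).rep (M i' j').rep ≠ 0 :=
      lorentzForm_rep_ne_zero (hM.mem_mobius _ _) (hM.mem_mobius _ _)
    have hq := hgen.quad_distinct i j
    refine exists_quad_relation (hn _ _) (hn _ _) (hn _ _) (hn _ _) (hd hq.1) (hd hq.2.2.1)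
      (hd hq.2.1) (hd (hgen.quad_distinct (i + 1) j).2.1) (hd hq.2.2.2)
      (hd (hgen.quad_distinct i (j + 1)).1.symm) ?_
    have hc := hM.circular i j
    rwa [Projectivization.submodule_eq, Projectivization.submodule_eq,
      Projectivization.submodule_eq, Projectivization.submodule_eq] at hc

theorem sup_eq_top (hgen : NetInGeneralPosition n M V H)
    (h : IsQNet (fun i j => (M i j).rep) V H) : V 0 ⊔ H 0 = ⊤ := by
  rw [eq_top_iff, ← hgen.net_span]
  refine iSup_le fun i => iSup_le fun j => ?_
  rw [Projectivization.submodule_eq, span_singleton_le_iff_mem]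
  exact h.V_sup_H_le i 0 (h.mem_V i j)

end Net

/-- A subspace that contains two null vectors that are not orthogonal is non-degenerate. -/
theorem eq_zero_of_orthogonal {U : Submodule ℝ (Amb n)} {p q : Amb n} (hp : p ∈ U) (hq : q ∈ U)
    (hp0 : lorentzForm n p p = 0) (hpq : lorentzForm n p q ≠ 0)
    {x : Amb n} (hx : x ∈ U) (h : ∀ y ∈ U, lorentzForm n x y = 0) : x = 0 := by
  by_contra hx0
  have hl := last_ne_zero_of_null (h x hx) hx0
  have e := smul_eq_smul_of_null (h x hx) hp0 (h p hp)
  have := congrArg (lorentzForm n · q) e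
  simp only [map_smul, LinearMap.smul_apply, h q hq, smul_eq_mul, mul_zero] at this
  exact (mul_ne_zero hl hpq) this.symm

end DarbouxNet

/-! ### Complex points, and touching along the contact space of a cone. -/

namespace DarbouxNet

open Submodule Module

variable {n : ℕ}

/-- The inclusion of the real points. -/
def toComplex (x : Amb n) : Fin (n + 2) → ℂ := fun k => (x k : ℂ)

theorem toComplex_mem {U : Submodule ℝ (Amb n)} {x : Amb n} (hx : x ∈ U) :
    toComplex x ∈ complexify U := subset_span ⟨x, hx, rfl⟩

theorem toComplex_smul (t : ℝ) (x : Amb n) : toComplex (t • x) = (t : ℂ) • toComplex x := by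
  ext k
  simp [toComplex]

theorem exists_eq_of_mem_complexify {U : Submodule ℝ (Amb n)} {p : Fin (n + 2) → ℂ}
    (hp : p ∈ complexify U) :
    ∃ x ∈ U, ∃ y ∈ U, p = toComplex x + Complex.I • toComplex y := by
  induction hp using span_induction with
  | mem p hp =>
    obtain ⟨x, hx, rfl⟩ := hp
    refine ⟨x, hx, 0, zero_mem _, ?_⟩
    ext k
    simp [toComplex]
  | zero =>
    refine ⟨0, zero_mem _, 0, zero_mem _, ?_⟩
    ext k
    simp [toComplex]
  | add p q _ _ hp hq =>
    obtain ⟨x, hx, y, hy, rfl⟩ := hp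
    obtain ⟨x', hx', y', hy', rfl⟩ := hq
    refine ⟨x + x', add_mem hx hx', y + y', add_mem hy hy', ?_⟩
    ext k
    simp [toComplex]
    ring
  | smul c p _ hp =>
    obtain ⟨x, hx, y, hy, rfl⟩ := hp
    refine ⟨c.re • x - c.im • y, sub_mem (smul_mem _ _ hx) (smul_mem _ _ hy),
      c.im • x + c.re • y, add_mem (smul_mem _ _ hx) (smul_mem _ _ hy), ?_⟩
    ext k
    apply Complex.ext
    · simp [toComplex]
    · simp [toComplex]
      ring

theorem complexify_mono {E U : Submodule ℝ (Amb n)} (h : E ≤ U) : complexify E ≤ complexify U :=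
  span_mono (Set.image_mono h)

section formC

variable (A : Matrix (Fin (n + 2)) (Fin (n + 2)) ℝ)

theorem formC_add_left (p q v : Fin (n + 2) → ℂ) :
    formC A (p + q) v = formC A p v + formC A q v := add_dotProduct _ _ _

theorem formC_smul_left (c : ℂ) (p v : Fin (n + 2) → ℂ) :
    formC A (c • p) v = c * formC A p v := smul_dotProduct _ _ _

theorem formC_add_right (p q v : Fin (n + 2) → ℂ) :
    formC A v (p + q) = formC A v p + formC A v q := by
  simp [formC, Matrix.mulVec_add]

theorem formC_smul_right (c : ℂ) (p v : Fin (n + 2) → ℂ) :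
    formC A v (c • p) = c * formC A v p := by
  simp [formC, Matrix.mulVec_smul]

theorem formC_toComplex (x y : Amb n) :
    formC A (toComplex x) (toComplex y) = (form A x y : ℂ) := by
  simp [formC, form, dotProduct, Matrix.mulVec, toComplex]

theorem formC_linearCombination {A L A' : Matrix (Fin (n + 2)) (Fin (n + 2)) ℝ} {c s : ℝ}
    (h : A' = c • L + s • A) (p q : Fin (n + 2) → ℂ) :
    formC A' p q = c * formC L p q + s * formC A p q := by
  have e : A'.map (fun r : ℝ => (r : ℂ)) =
      (c : ℂ) • L.map (fun r : ℝ => (r : ℂ)) + (s : ℂ) • A.map (fun r : ℝ => (r : ℂ)) := by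
    ext i j
    simp [h]
  simp [formC, e, Matrix.add_mulVec, Matrix.smul_mulVec]

theorem formC_eq_zero {S T : Submodule ℝ (Amb n)} (h : ∀ x ∈ S, ∀ y ∈ T, form A x y = 0)
    {p q : Fin (n + 2) → ℂ} (hp : p ∈ complexify S) (hq : q ∈ complexify T) : formC A p q = 0 := by
  obtain ⟨x, hx, y, hy, rfl⟩ := exists_eq_of_mem_complexify hp
  obtain ⟨x', hx', y', hy', rfl⟩ := exists_eq_of_mem_complexify hq
  simp only [formC_add_left, formC_smul_left, formC_add_right, formC_smul_right, formC_toComplex,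
    h x hx x' hx', h x hx y' hy', h y hy x' hx', h y hy y' hy']
  simp

end formC

theorem eq_zero_of_add_mul_I {a b : ℝ} (h : (a : ℂ) + Complex.I * b = 0) : a = 0 ∧ b = 0 := by
  have h1 := congrArg Complex.re h
  have h2 := congrArg Complex.im h
  simpa using And.intro h1 h2

theorem form_linearCombination {A L A' : Matrix (Fin (n + 2)) (Fin (n + 2)) ℝ} {c s : ℝ}
    (h : A' = c • L + s • A) (x y : Amb n) :
    form A' x y = c * form L x y + s * form A x y := by
  simp [form, h, Matrix.add_mulVec, Matrix.smul_mulVec]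

/-- If a quadratic cone contains a sphere, and its apex lies in the span of the sphere but not on
the Möbius quadric, then any two points of the sphere are conjugate for the cone. -/
theorem form_eq_zero_of_null_null {A : Matrix (Fin (n + 2)) (Fin (n + 2)) ℝ} (hA : A.IsSymm)
    {U : Submodule ℝ (Amb n)} {Y : Amb n} (hYU : Y ∈ U) (hY : lorentzForm n Y Y ≠ 0)
    (hAY : ∀ w, form A Y w = 0)
    (h : ∀ u ∈ U, lorentzForm n u u = 0 → form A u u = 0) {u v : Amb n} (hu : u ∈ U) (hv : v ∈ U)
    (hu0 : lorentzForm n u u = 0) (hv0 : lorentzForm n v v = 0) : form A u v = 0 := by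
  -- The line from `u + t • v` to the apex is to meet the Möbius quadric in a real point; the sign
  -- of `t` makes the discriminant of the quadratic equation for `s` nonnegative.
  obtain ⟨t, ht, htl⟩ : ∃ t : ℝ, t ≠ 0 ∧ t * (lorentzForm n u v * lorentzForm n Y Y) ≤ 0 := by
    rcases le_total (lorentzForm n u v * lorentzForm n Y Y) 0 with h1 | h1
    · exact ⟨1, one_ne_zero, by linarith⟩
    · exact ⟨-1, by norm_num, by linarith⟩
  set l := lorentzForm n u v with hl
  set y := lorentzForm n Y Y with hy
  set b := lorentzForm n u Y + t * lorentzForm n v Y with hb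
  have hsq := Real.mul_self_sqrt (show 0 ≤ b * b - 2 * t * l * y by nlinarith [mul_self_nonneg b])
  set r := Real.sqrt (b * b - 2 * t * l * y)
  obtain ⟨s, hs⟩ : ∃ s : ℝ, s = (-b + r) / y := ⟨_, rfl⟩
  have hs' : s * y = -b + r := by rw [hs, div_mul_cancel₀ _ hY]
  have hnull : lorentzForm n (u + t • v + s • Y) (u + t • v + s • Y) = 0 := by
    simp only [map_add, map_smul, LinearMap.add_apply, LinearMap.smul_apply, smul_eq_mul, hu0, hv0,
      lorentzForm_comm v u, lorentzForm_comm Y u, lorentzForm_comm Y v, ← hl, ← hy]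
    have : y * (2 * t * l + 2 * s * b + s * s * y) = 0 := by
      linear_combination (s * y + b + r) * hs' + hsq
    have := (mul_eq_zero.1 this).resolve_left hY
    linear_combination this + 2 * s * hb
  have h0 := h _ (add_mem (add_mem hu (smul_mem _ t hv)) (smul_mem _ s hYU)) hnull
  have hAu := h u hu hu0
  have hAv := h v hv hv0
  have hYu := hAY u
  have hYv := hAY v
  have hYY := hAY Y
  have huY := form_comm hA u Y
  have hvY := form_comm hA v Y
  have hvu := form_comm hA v u
  simp only [form_eq_toBilin'] at *
  simp only [map_add, map_smul, LinearMap.add_apply, LinearMap.smul_apply, smul_eq_mul, hAu, hAv,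
    hYu, hYv, hYY, huY, hvY, hvu] at h0
  have : (2 * t) * Matrix.toBilin' A u v = 0 := by linarith
  simpa [ht] using this

/-- A sphere in whose span a quadratic cone, with apex in this span, degenerates along `E`,
touches the cyclides in the pencil of the cone and the Möbius quadric along the subsphere cut out
by `E`. -/
theorem touchesAlong_of_cone {A A' : Matrix (Fin (n + 2)) (Fin (n + 2)) ℝ} (hA : A.IsSymm)
    {c s : ℝ} (hs : s ≠ 0) (hA' : A' = c • lorentz n + s • A)
    {U E : Submodule ℝ (Amb n)} {Y : Amb n} (hEU : E ≤ U) (hYU : Y ∈ U)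
    (hY : lorentzForm n Y Y ≠ 0) (hAY : ∀ w, form A Y w = 0)
    (hrad : ∀ x, (∀ w, form A x w = 0) → ∃ t : ℝ, x = t • Y)
    (hE : ∀ e ∈ E, ∀ u ∈ U, form A e u = 0)
    (hU : ∀ x ∈ U, (∀ y ∈ U, lorentzForm n x y = 0) → x = 0)
    (hspan : ∃ S : Set (Amb n), (∀ x ∈ S, lorentzForm n x x = 0) ∧ span ℝ S = U)
    (hne : ∃ u ∈ U, form A u u ≠ 0) : TouchesAlong n A' U E := by
  have hE' : ∀ u ∈ U, ∀ e ∈ E, form A u e = 0 := fun u hu e he => by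
    rw [form_comm hA, hE e he u hu]
  refine ⟨hEU, fun hsub => ?_, fun p hp hp0 hpn => ?_⟩
  · have hnull : ∀ u ∈ U, lorentzForm n u u = 0 → form A u u = 0 := by
      intro u hu hu0
      by_cases h0 : u = 0
      · rw [h0, form_eq_toBilin', map_zero]
      obtain ⟨t, ht⟩ := Projectivization.exists_smul_eq_mk_rep ℝ u h0
      have hrep : (t : ℝ) • u = (Projectivization.mk ℝ u h0).rep := ht
      have ht0 : (t : ℝ) ≠ 0 := t.ne_zero
      have h1 := hsub (show Projectivization.mk ℝ u h0 ∈ sphereOf n U by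
        refine ⟨?_, ?_⟩
        · rw [Set.mem_ofPred_eq, Projectivization.submodule_eq, span_singleton_le_iff_mem, ← hrep]
          exact smul_mem _ _ hu
        · rw [mem_mobiusQuadric, ← hrep]
          simp [hu0])
      have h2 : form A' _ _ = 0 := h1.1
      rw [form_linearCombination hA', form_lorentz, ← hrep, form_eq_toBilin'] at h2
      simpa [hu0, hs, ht0, form_eq_toBilin'] using h2
    -- Null vectors span `U` and would be pairwise conjugate for `A`, so `A` would vanish on `U`.
    obtain ⟨S, hS, hSU⟩ := hspan
    obtain ⟨u, hu, hAu⟩ := hne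
    apply hAu
    rw [form_eq_toBilin']
    refine form_eq_zero_of_span (b := ((↑) : S → Amb n)) (by rw [Subtype.range_coe, hSU])
      (fun x y => ?_) u hu u hu
    rw [← form_eq_toBilin']
    exact form_eq_zero_of_null_null hA hYU hY hAY hnull (hSU ▸ subset_span x.2)
      (hSU ▸ subset_span y.2) (hS x x.2) (hS y y.2)
  · have hpU := complexify_mono hEU hp
    refine ⟨hpU, hpn, ?_, ?_, fun v hv hpv => ?_⟩
    · rw [formC_linearCombination hA', hpn, formC_eq_zero A hE hp hpU]
      simp
    · obtain ⟨x, hx, y, hy, hxy⟩ := exists_eq_of_mem_complexify hp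
      rw [LinearIndependent.pair_iff]
      intro α β hαβ
      have key : ∀ v, (α + β * c) * formC (lorentz n) v p + β * s * formC A v p = 0 := by
        intro v
        have h1 := congrArg (v ⬝ᵥ ·) hαβ
        simp only [dotProduct_add, dotProduct_smul, dotProduct_zero, smul_eq_mul] at h1
        change α * formC (lorentz n) v p + β * formC A' v p = 0 at h1
        rw [formC_linearCombination hA'] at h1
        linear_combination h1
      have hreal : ∀ (B : Matrix (Fin (n + 2)) (Fin (n + 2)) ℝ) (u : Amb n),
          formC B (toComplex u) p = 0 → form B u x = 0 ∧ form B u y = 0 := by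
        intro B u h
        rw [hxy, formC_add_right, formC_smul_right, formC_toComplex, formC_toComplex] at h
        exact eq_zero_of_add_mul_I h
      -- `A p` vanishes on `U`, so otherwise `p` would be Lorentz-orthogonal to `U`, on which the
      -- product is nondegenerate.
      have h1 : α + β * c = 0 := by
        by_contra h1
        have h2 : ∀ u ∈ U, formC (lorentz n) (toComplex u) p = 0 := by
          intro u hu
          have := key (toComplex u)
          rw [formC_eq_zero A hE' (toComplex_mem hu) hp] at this
          simpa [h1] using this
        have hx0 := hU x (hEU hx) fun u hu => by
          rw [lorentzForm_comm, ← form_lorentz]; exact (hreal _ u (h2 u hu)).1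
        have hy0 := hU y (hEU hy) fun u hu => by
          rw [lorentzForm_comm, ← form_lorentz]; exact (hreal _ u (h2 u hu)).2
        apply hp0
        rw [hxy, hx0, hy0]
        ext k
        simp [toComplex]
      -- Otherwise `p` lies in the radical of `A`, so it is a multiple of the apex, which is not
      -- null.
      have hβ : β = 0 := by
        by_contra hβ
        have h2 : ∀ u, formC A (toComplex u) p = 0 := by
          intro u
          simpa [h1, hβ, hs] using key (toComplex u)
        obtain ⟨t, rfl⟩ := hrad x fun w => by rw [form_comm hA]; exact (hreal _ w (h2 w)).1
        obtain ⟨t', rfl⟩ := hrad y fun w => by rw [form_comm hA]; exact (hreal _ w (h2 w)).2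
        have hpY : p = ((t : ℂ) + Complex.I * t') • toComplex Y := by
          rw [hxy, toComplex_smul, toComplex_smul, smul_smul, ← add_smul]
        rw [hpY, formC_smul_left, formC_smul_right, formC_toComplex, form_lorentz] at hpn
        have h3 : (t : ℂ) + Complex.I * t' = 0 := by simpa [hY] using hpn
        exact hp0 (by rw [hpY, h3, zero_smul])
      exact ⟨by simpa [hβ] using h1, hβ⟩
    · rw [formC_linearCombination hA', hpv, formC_eq_zero A hE hp hv]
      simp

end DarbouxNet

/-! ### Isotropic families in dimension 7, the dual quadric, and the projected contour. -/

namespace DarbouxNet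

open Submodule Module

variable {n : ℕ} {Z : Type*} [AddCommGroup Z] [Module ℝ Z]

theorem isSymm_toMatrix' {A : LinearMap.BilinForm ℝ (Amb n)} (hA : ∀ x y, A x y = A y x) :
    A.toMatrix'.IsSymm := by
  ext a b
  simp only [Matrix.transpose_apply, LinearMap.BilinForm.toMatrix'_apply]
  exact hA _ _

theorem exists_generalizedInverse {Z Z' : Type*} [AddCommGroup Z] [Module ℝ Z] [AddCommGroup Z']
    [Module ℝ Z'] (f : Z →ₗ[ℝ] Z') : ∃ τ : Z' →ₗ[ℝ] Z, ∀ z, f (τ (f z)) = f z := by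
  obtain ⟨s, hs⟩ := LinearMap.exists_rightInverse_of_surjective f.rangeRestrict
    (LinearMap.range_rangeRestrict f)
  obtain ⟨τ, hτ⟩ := LinearMap.exists_extend s
  refine ⟨τ, fun z => ?_⟩
  have h1 : τ (f z) = s (f.rangeRestrict z) := LinearMap.congr_fun hτ (f.rangeRestrict z)
  rw [h1]
  exact congrArg Subtype.val (LinearMap.congr_fun hs (f.rangeRestrict z))

/-- The subspaces `V i` are projections of subspaces of a seven-dimensional space that are
isotropic for a form, and this form agrees with the Lorentz product on some four-dimensional
subspace. -/
structure IsIsotropicLift (π : Z →ₗ[ℝ] Amb n) (V : ℤ → Submodule ℝ (Amb n))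
    (V' : ℤ → Submodule ℝ Z) (H' : Submodule ℝ Z) (B : LinearMap.BilinForm ℝ Z) : Prop where
  finrank_eq : finrank ℝ Z = 7
  surj : Function.Surjective π
  lift : IsFamilyLift π V V'
  finrank_V' : ∀ i, finrank ℝ (V' i) = 4
  symm : ∀ x y, B x y = B y x
  isotropic : ∀ i, ∀ x ∈ V' i, ∀ y ∈ V' i, B x y = 0
  finrank_H' : finrank ℝ H' = 4
  inj_H' : ∀ x ∈ H', π x = 0 → x = 0
  eq_on_H' : ∀ x ∈ H', ∀ y ∈ H', B x y = lorentzForm n (π x) (π y)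
  nondeg : ∀ i, ∀ x ∈ V i, (∀ y ∈ V i, lorentzForm n x y = 0) → x = 0
  span_null : ∀ i, ∃ S : Set (Amb n), (∀ x ∈ S, lorentzForm n x x = 0) ∧ span ℝ S = V i

namespace IsIsotropicLift

variable {π : Z →ₗ[ℝ] Amb n} {V : ℤ → Submodule ℝ (Amb n)} {V' : ℤ → Submodule ℝ Z}
  {H' : Submodule ℝ Z} {B : LinearMap.BilinForm ℝ Z}

/-- On `H'` the form is the Lorentz product of the projections, which has no isotropic planes. -/
theorem finrank_inf_H'_le (h : IsIsotropicLift π V V' H' B) {A : Submodule ℝ Z}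
    (hA : ∀ x ∈ A, ∀ y ∈ A, B x y = 0) : finrank ℝ (A ⊓ H' : Submodule ℝ Z) ≤ 1 := by
  have hinj : Function.Injective (π.domRestrict (A ⊓ H')) := by
    rw [← LinearMap.ker_eq_bot, LinearMap.ker_eq_bot']
    exact fun x hx => Subtype.ext (h.inj_H' x x.2.2 hx)
  rw [← LinearMap.finrank_range_of_inj hinj]
  refine finrank_le_one_of_isotropic ?_
  rintro _ ⟨x, rfl⟩ _ ⟨y, rfl⟩
  change lorentzForm n (π x) (π y) = 0
  rw [← h.eq_on_H' x x.2.2 y y.2.2, hA x x.2.1 y y.2.1]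

theorem mem_orthogonal (h : IsIsotropicLift π V V' H' B) {A : Submodule ℝ Z} {x : Z} :
    x ∈ B.orthogonal A ↔ ∀ y ∈ A, B x y = 0 := by
  rw [LinearMap.BilinForm.mem_orthogonal_iff]
  exact forall₂_congr fun y _ => by rw [h.symm y x]

theorem mem_ker {x : Z} : x ∈ LinearMap.ker B ↔ ∀ z, B x z = 0 := by
  rw [LinearMap.mem_ker, LinearMap.ext_iff]
  rfl

/-- Functionals given by vectors that are orthogonal to the kernel of the projection descend. -/
theorem exists_descent (h : IsIsotropicLift π V V' H' B) {z : Z}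
    (hz : ∀ k, π k = 0 → B z k = 0) : ∃ x : Amb n, ∀ w, B z w = lorentzForm n x (π w) := by
  obtain ⟨ρ, hρ⟩ := LinearMap.exists_rightInverse_of_surjective π (LinearMap.range_eq_top.2 h.surj)
  have hinj : Function.Injective (lorentzForm n) := by
    rw [← LinearMap.ker_eq_bot, LinearMap.ker_eq_bot']
    exact fun x hx => lorentzForm_nondegenerate fun y => LinearMap.congr_fun hx y
  have hsurj : Function.Surjective (lorentzForm n) :=
    (LinearMap.injective_iff_surjective_of_finrank_eq_finrank
      (Subspace.dual_finrank_eq (K := ℝ) (V := Amb n)).symm).1 hinj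
  obtain ⟨x, hx⟩ := hsurj ((B z).comp ρ)
  refine ⟨x, fun w => ?_⟩
  rw [hx]
  have h1 : π (w - ρ (π w)) = 0 := by
    have : π (ρ (π w)) = π w := LinearMap.congr_fun hρ (π w)
    rw [map_sub, this, sub_self]
  have h2 := hz _ h1
  rw [map_sub, sub_eq_zero] at h2
  exact h2

theorem mem_polarSpace {U : Submodule ℝ (Amb n)} {x : Amb n} :
    x ∈ polarSpace n U ↔ ∀ u ∈ U, lorentzForm n x u = 0 :=
  forall₂_congr fun u _ => by rw [form_lorentz, lorentzForm_comm]

theorem mem_polarSpace_singleton {y x : Amb n} :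
    x ∈ polarSpace n (span ℝ {y}) ↔ lorentzForm n x y = 0 := by
  rw [mem_polarSpace]
  refine ⟨fun h => h y (mem_span_singleton_self y), fun h u hu => ?_⟩
  obtain ⟨t, rfl⟩ := mem_span_singleton.1 hu
  simp [h]

variable [FiniteDimensional ℝ Z]

/-- An isotropic `A` meets `H'` in dimension at most 1, so dim `A` + 4 - 1 ≤ 7. The spaces `V' i`
are thus maximal isotropic, and in particular contain the radical. -/
theorem finrank_le_four (h : IsIsotropicLift π V V' H' B) {A : Submodule ℝ Z}
    (hA : ∀ x ∈ A, ∀ y ∈ A, B x y = 0) : finrank ℝ A ≤ 4 := by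
  have h1 := h.finrank_inf_H'_le hA
  have h2 := finrank_sup_add_finrank_inf_eq A H'
  have h3 := (A ⊔ H').finrank_le
  rw [h.finrank_H'] at h2
  rw [h.finrank_eq] at h3
  omega

theorem mem_of_radical (h : IsIsotropicLift π V V' H' B) (i : ℤ) {x : Z} (hx : ∀ z, B x z = 0) :
    x ∈ V' i := by
  have hx' : ∀ z, B z x = 0 := fun z => by rw [h.symm, hx]
  have hA : ∀ y ∈ V' i ⊔ span ℝ {x}, ∀ z ∈ V' i ⊔ span ℝ {x}, B y z = 0 := by
    intro y hy z hz
    obtain ⟨v, hv, v', hv', rfl⟩ := mem_sup.1 hy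
    obtain ⟨t, rfl⟩ := mem_span_singleton.1 hv'
    obtain ⟨w, hw, w', hw', rfl⟩ := mem_sup.1 hz
    obtain ⟨u, rfl⟩ := mem_span_singleton.1 hw'
    simp [hx, hx', h.isotropic i v hv w hw]
  have := eq_of_le_of_finrank_le (le_sup_left : V' i ≤ V' i ⊔ span ℝ {x})
    (by rw [h.finrank_V']; exact h.finrank_le_four hA)
  rw [this]
  exact mem_sup_right (mem_span_singleton_self x)

/-- The radical of the form is spanned by a vector over the common point of the `V i`. -/
theorem exists_apex (h : IsIsotropicLift π V V' H' B) (hV : FamilyInGeneralPosition n V) :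
    ∃ Y : Z, LinearMap.ker B = span ℝ {Y} ∧ Y ≠ 0 ∧ (⨅ i, V i) = span ℝ {π Y} ∧
      lorentzForm n (π Y) (π Y) ≠ 0 := by
  -- dim `V' 0` + dim of its orthogonal space = 7 + dim (`V' 0` ∩ radical), and both terms on the
  -- left are at least 4; so the radical is nonzero.
  have h1 := LinearMap.BilinForm.finrank_add_finrank_orthogonal' (B := B) (V' 0)
  have hle : V' 0 ≤ B.orthogonal (V' 0) := fun x hx =>
    h.mem_orthogonal.2 fun y hy => h.isotropic 0 x hx y hy
  have h2 := finrank_mono hle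
  rw [h.finrank_V', h.finrank_eq] at h1
  rw [h.finrank_V'] at h2
  have hpos : 0 < finrank ℝ (V' 0 ⊓ LinearMap.ker B : Submodule ℝ Z) := by omega
  obtain ⟨⟨Y, hYV, hYk⟩, hY0⟩ := (finrank_pos_iff_exists_ne_zero).1 hpos
  have hY0' : Y ≠ 0 := fun h0 => hY0 (Subtype.ext h0)
  have hmem : ∀ x ∈ LinearMap.ker B, π x ∈ ⨅ i, V i := fun x hx =>
    (mem_iInf _).2 fun i => h.lift.map i ▸ mem_map_of_mem (h.mem_of_radical i (mem_ker.1 hx))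
  have hπY : π Y ≠ 0 := fun h0 => hY0' (h.lift.inj 0 Y hYV h0)
  have hspan : (⨅ i, V i) = span ℝ {π Y} := by
    symm
    apply eq_of_le_of_finrank_eq
    · rw [span_singleton_le_iff_mem]
      exact hmem Y hYk
    · rw [finrank_span_singleton hπY, hV.common_point]
  refine ⟨Y, le_antisymm (fun x hx => ?_) ?_, hY0', hspan, fun hnull => ?_⟩
  · have := hmem x hx
    rw [hspan, mem_span_singleton] at this
    obtain ⟨t, ht⟩ := this
    rw [mem_span_singleton]
    refine ⟨t, ?_⟩
    rw [← sub_eq_zero]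
    refine h.lift.inj 0 _ (sub_mem (smul_mem _ _ hYV) (h.mem_of_radical 0 (mem_ker.1 hx))) ?_
    rw [map_sub, map_smul, ht, sub_self]
  · rwa [span_singleton_le_iff_mem]
  · obtain ⟨t, ht⟩ := Projectivization.exists_smul_eq_mk_rep ℝ _ hπY
    have hrep : (t : ℝ) • π Y = (Projectivization.mk ℝ (π Y) hπY).rep := ht
    have : Projectivization.mk ℝ (π Y) hπY ∈ ⋂ i, sphereOf n (V i) := by
      rw [Set.mem_iInter]
      refine fun i => ⟨?_, ?_⟩
      · rw [Set.mem_ofPred_eq, Projectivization.submodule_mk, span_singleton_le_iff_mem]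
        exact (mem_iInf _).1 (hmem Y hYk) i
      · rw [mem_mobiusQuadric, ← hrep]
        simp [hnull]
    rw [hV.no_common_point_on_spheres] at this
    exact this

/-- With a one-dimensional radical, the orthogonal space of `V' i` has dimension at most 7 + 1 - 4 =
4, so it is `V' i` itself. -/
theorem mem_of_orthogonal (h : IsIsotropicLift π V V' H' B) {Y : Z}
    (hY : LinearMap.ker B = span ℝ {Y}) (hY0 : Y ≠ 0) (i : ℤ) {x : Z}
    (hx : ∀ y ∈ V' i, B x y = 0) : x ∈ V' i := by
  have h1 := LinearMap.BilinForm.finrank_add_finrank_orthogonal' (B := B) (V' i)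
  have hle : V' i ≤ B.orthogonal (V' i) := fun x hx =>
    h.mem_orthogonal.2 fun y hy => h.isotropic i x hx y hy
  have h2 := finrank_mono (inf_le_right : V' i ⊓ LinearMap.ker B ≤ _)
  rw [hY, finrank_span_singleton hY0] at h2
  rw [hY, h.finrank_V', h.finrank_eq] at h1
  rw [eq_of_le_of_finrank_le hle (by rw [h.finrank_V']; omega)]
  exact h.mem_orthogonal.2 hx

theorem finrank_ker (h : IsIsotropicLift π V V' H' B) : finrank ℝ (LinearMap.ker π) + n = 5 := by
  have := LinearMap.finrank_range_add_finrank_ker π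
  rw [LinearMap.range_eq_top.2 h.surj, finrank_top, h.finrank_eq, finrank_fin_fun] at this
  omega

/-- Functionals on the projected space that vanish at the apex are represented by the form. -/
theorem exists_section (h : IsIsotropicLift π V V' H' B) {Y : Z}
    (hY : LinearMap.ker B = span ℝ {Y}) :
    ∃ σ : Amb n →ₗ[ℝ] Z, ∀ x, lorentzForm n x (π Y) = 0 →
      ∀ z, B (σ x) z = lorentzForm n x (π z) := by
  obtain ⟨τ, hτ⟩ := exists_generalizedInverse (Z' := Dual ℝ Z) B
  -- A functional is represented by `B` exactly when it vanishes on the radical.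
  have hrange : LinearMap.range B = (span ℝ {Y}).dualAnnihilator := by
    apply eq_of_le_of_finrank_eq
    · rintro _ ⟨z, rfl⟩
      rw [mem_dualAnnihilator]
      intro w hw
      rw [← hY, mem_ker] at hw
      rw [h.symm, hw]
    · have h1 := LinearMap.finrank_range_add_finrank_ker B
      have h2 := Subspace.finrank_add_finrank_dualAnnihilator_eq (span ℝ {Y})
      rw [hY] at h1
      exact Nat.add_right_cancel (h1.trans (h2.symm.trans (add_comm _ _)))
  refine ⟨τ.comp (π.dualMap.comp (lorentzForm n)), fun x hx z => ?_⟩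
  have hmem : π.dualMap (lorentzForm n x) ∈ LinearMap.range B := by
    rw [hrange, mem_dualAnnihilator]
    intro w hw
    obtain ⟨t, rfl⟩ := mem_span_singleton.1 hw
    simp [hx]
  obtain ⟨w, hw⟩ := hmem
  change B (τ (π.dualMap (lorentzForm n x))) z = _
  rw [← hw, hτ, hw]
  rfl

/-- The quadric in the polar hyperplane of the apex that is dual to the form. -/
theorem exists_dual_quadric (h : IsIsotropicLift π V V' H' B) (hn : 3 ≤ n) {Y : Z}
    (hY : LinearMap.ker B = span ℝ {Y}) (hY0 : Y ≠ 0) (hVY : (⨅ i, V i) = span ℝ {π Y}) :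
    ∃ (σ : Amb n →ₗ[ℝ] Z) (Ψ : LinearMap.BilinForm ℝ (polarSpace n (⨅ i, V i))),
      (∀ x ∈ polarSpace n (⨅ i, V i), ∀ z, B (σ x) z = lorentzForm n x (π z)) ∧
      (∀ x y, Ψ x y = B (σ x) (σ y)) ∧ ContainsPolars n V Ψ := by
  obtain ⟨σ, hσ⟩ := h.exists_section hY
  have hσ' : ∀ x ∈ polarSpace n (⨅ i, V i), ∀ z, B (σ x) z = lorentzForm n x (π z) :=
    fun x hx => hσ x (by rwa [hVY, mem_polarSpace_singleton] at hx)
  let ι := (polarSpace n (⨅ i, V i)).subtype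
  refine ⟨σ, B.compl₁₂ (σ.comp ι) (σ.comp ι), hσ', fun x y => rfl, fun x y => h.symm _ _,
    fun h0 => ?_, fun i x hx => ?_⟩
  -- The vectors of `H'` orthogonal to N form a space of dimension at least 4 - (5 - n) ≥ 2. If `Ψ`
  -- were zero, this space would be isotropic, contradicting the bound 1.
  · let N := LinearMap.ker π
    let φ : H' →ₗ[ℝ] Dual ℝ N := (LinearMap.lcomp ℝ ℝ N.subtype).comp (B.domRestrict H')
    have h1 := LinearMap.finrank_range_add_finrank_ker φ
    have h2 := (LinearMap.range φ).finrank_le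
    rw [Subspace.dual_finrank_eq] at h2
    have h3 : finrank ℝ N + n = 5 := h.finrank_ker
    rw [h.finrank_H'] at h1
    have h4 : 2 ≤ finrank ℝ (LinearMap.ker φ) := by omega
    have h5 : finrank ℝ ((LinearMap.ker φ).map H'.subtype) = finrank ℝ (LinearMap.ker φ) :=
      finrank_map_subtype_eq _ _
    have h6 := h.finrank_inf_H'_le (A := (LinearMap.ker φ).map H'.subtype) (by
      have hdesc : ∀ x ∈ (LinearMap.ker φ).map H'.subtype,
          ∃ y : polarSpace n (⨅ i, V i), ∀ w, B (σ y) w = B x w := by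
        rintro _ ⟨x, hx, rfl⟩
        obtain ⟨y, hy⟩ := h.exists_descent (z := x) fun k hk =>
          LinearMap.congr_fun (LinearMap.mem_ker.1 hx) ⟨k, hk⟩
        have hyY : lorentzForm n y (π Y) = 0 := by
          rw [← hy, h.symm]
          exact mem_ker.1 (hY ▸ mem_span_singleton_self Y) _
        have hyP : y ∈ polarSpace n (⨅ i, V i) := by rwa [hVY, mem_polarSpace_singleton]
        exact ⟨⟨y, hyP⟩, fun w => by rw [hσ' y hyP]; exact (hy w).symm⟩
      intro x hx x' hx'
      obtain ⟨y, hy⟩ := hdesc x hx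
      obtain ⟨y', hy'⟩ := hdesc x' hx'
      have := LinearMap.congr_fun (LinearMap.congr_fun h0 y) y'
      rw [← hy, h.symm, ← hy', h.symm]
      exact this)
    rw [inf_eq_left.2 (map_subtype_le _ _), h5] at h6
    omega
  · have hx' : σ x ∈ V' i := h.mem_of_orthogonal hY hY0 i fun y hy => by
      rw [hσ' x x.2]
      exact mem_polarSpace.1 hx _ (h.lift.map i ▸ mem_map_of_mem hy)
    exact h.isotropic i _ hx' _ hx'

/-- The kernel of the projection is a non-degenerate subspace. -/
theorem eq_zero_of_mem_ker (h : IsIsotropicLift π V V' H' B) (hn : 3 ≤ n)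
    (hV : FamilyInGeneralPosition n V) {k : Z} (hk : π k = 0)
    (hk' : ∀ k', π k' = 0 → B k k' = 0) : k = 0 := by
  obtain ⟨Y, hY, hY0, hVY, -⟩ := h.exists_apex hV
  obtain ⟨σ, Ψ, hσ, hΨ, hc⟩ := h.exists_dual_quadric hn hY hY0 hVY
  obtain ⟨x, hx⟩ := h.exists_descent hk'
  have hBY : ∀ z, B z Y = 0 := fun z => by
    rw [h.symm]
    exact mem_ker.1 (hY ▸ mem_span_singleton_self Y) z
  have hxP : x ∈ polarSpace n (⨅ i, V i) := by
    rw [hVY, mem_polarSpace_singleton, ← hx, hBY]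
  -- The vector `x` representing `B k` is a singular point of `Ψ`: pairing it with `w` gives the
  -- Lorentz product of `w` and `π k = 0`.
  have hx0 : (⟨x, hxP⟩ : polarSpace n (⨅ i, V i)) = 0 := by
    refine hV.polar_quadric Ψ hc _ fun w => ?_
    rw [hΨ, hσ x hxP, ← hx, h.symm, hσ w w.2, hk, map_zero]
  have hx0' : x = 0 := congrArg Subtype.val hx0
  have hkr : ∀ z, B k z = 0 := fun z => by rw [hx, hx0', map_zero, LinearMap.zero_apply]
  exact h.lift.inj 0 k (h.mem_of_radical 0 hkr) hk

/-- A form on the projected space that is induced by a form on the orthogonal space of the kernel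
of the projection. -/
def IsInduced (π : Z →ₗ[ℝ] Amb n) (B : LinearMap.BilinForm ℝ Z)
    (A : LinearMap.BilinForm ℝ (Amb n)) : Prop :=
  (∀ x y, A x y = A y x) ∧ ∀ x, (∀ k, π k = 0 → B x k = 0) → ∀ y, A (π x) (π y) = B x y

theorem finrank_orthogonal_ker (h : IsIsotropicLift π V V' H' B) :
    finrank ℝ (B.orthogonal (LinearMap.ker π)) = n + 2 := by
  have h1 := LinearMap.BilinForm.finrank_add_finrank_orthogonal' (B := B) (LinearMap.ker π)
  have h2 : LinearMap.ker π ⊓ LinearMap.ker B = ⊥ := by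
    rw [eq_bot_iff]
    rintro x ⟨hx, hx'⟩
    exact h.lift.inj 0 x (h.mem_of_radical 0 (mem_ker.1 hx')) hx
  rw [h2, finrank_bot, h.finrank_eq] at h1
  have := h.finrank_ker
  omega

/-- Nondegeneracy of N makes π an isomorphism from the orthogonal space of N onto the ambient space,
so `B` restricted there can be transported. -/
theorem exists_isInduced (h : IsIsotropicLift π V V' H' B)
    (hN : ∀ k, π k = 0 → (∀ k', π k' = 0 → B k k' = 0) → k = 0) : ∃ A, IsInduced π B A := by
  let P := B.orthogonal (LinearMap.ker π)
  have hP : ∀ {x}, x ∈ P ↔ ∀ k, π k = 0 → B x k = 0 := h.mem_orthogonal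
  have hinj : Function.Injective (π.domRestrict P) := by
    rw [← LinearMap.ker_eq_bot, LinearMap.ker_eq_bot']
    exact fun x hx => Subtype.ext (hN x hx (hP.1 x.2))
  have hsurj : Function.Surjective (π.domRestrict P) :=
    (LinearMap.injective_iff_surjective_of_finrank_eq_finrank (by
      rw [h.finrank_orthogonal_ker, finrank_fin_fun])).1 hinj
  obtain ⟨ρ, hρ⟩ := LinearMap.exists_rightInverse_of_surjective _ (LinearMap.range_eq_top.2 hsurj)
  have hρ' : ∀ w, π (ρ w) = w := fun w => LinearMap.congr_fun hρ w
  refine ⟨B.compl₁₂ (P.subtype.comp ρ) (P.subtype.comp ρ), fun x y => h.symm _ _, fun x hx y => ?_⟩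
  change B (ρ (π x)) (ρ (π y)) = B x y
  have h1 : (ρ (π x) : Z) = x := by
    rw [← sub_eq_zero]
    refine hN _ (by rw [map_sub, hρ', sub_self]) fun k hk => ?_
    rw [map_sub, LinearMap.sub_apply, hP.1 (ρ (π x)).2 k hk, hx k hk, sub_self]
  rw [h1, ← sub_eq_zero, ← map_sub]
  exact hx _ (by rw [map_sub, hρ', sub_self])

/-- The subspace of `V i` along which the cone degenerates. -/
def contact (π : Z →ₗ[ℝ] Amb n) (V' : ℤ → Submodule ℝ Z) (B : LinearMap.BilinForm ℝ Z) (i : ℤ) :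
    Submodule ℝ (Amb n) := (V' i ⊓ B.orthogonal (LinearMap.ker π)).map π

/-- The space is the orthogonal space of `V' i ⊔ ker π`, which has dimension 9 - n and contains the
radical; hence the dimension 7 + 1 - (9 - n) = n - 1. -/
theorem finrank_inf_orthogonal (h : IsIsotropicLift π V V' H' B) {Y : Z}
    (hY : LinearMap.ker B = span ℝ {Y}) (hY0 : Y ≠ 0) (i : ℤ) :
    finrank ℝ (V' i ⊓ B.orthogonal (LinearMap.ker π) : Submodule ℝ Z) + 1 = n := by
  have e : V' i ⊓ B.orthogonal (LinearMap.ker π) = B.orthogonal (V' i ⊔ LinearMap.ker π) := by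
    ext x
    rw [mem_inf, h.mem_orthogonal, h.mem_orthogonal]
    constructor
    · rintro ⟨hx, hx'⟩ y hy
      obtain ⟨v, hv, z, hz, rfl⟩ := mem_sup.1 hy
      rw [map_add, h.isotropic i x hx v hv, hx' z hz, add_zero]
    · exact fun hx => ⟨h.mem_of_orthogonal hY hY0 i fun y hy => hx y (mem_sup_left hy),
        fun y hy => hx y (mem_sup_right hy)⟩
  have h1 := LinearMap.BilinForm.finrank_add_finrank_orthogonal' (B := B) (V' i ⊔ LinearMap.ker π)
  have h2 := finrank_sup_add_finrank_inf_eq (V' i) (LinearMap.ker π)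
  have h3 : V' i ⊓ LinearMap.ker π = ⊥ := by
    rw [eq_bot_iff]
    rintro x ⟨hx, hx'⟩
    exact h.lift.inj i x hx hx'
  have h4 : (V' i ⊔ LinearMap.ker π) ⊓ LinearMap.ker B = span ℝ {Y} := by
    rw [← hY]
    exact inf_eq_right.2 fun x hx => mem_sup_left (h.mem_of_radical i (mem_ker.1 hx))
  rw [h3, finrank_bot, h.finrank_V'] at h2
  rw [h4, finrank_span_singleton hY0, h.finrank_eq] at h1
  have h5 := h.finrank_ker
  rw [e]
  omega

theorem finrank_contact (h : IsIsotropicLift π V V' H' B) {Y : Z}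
    (hY : LinearMap.ker B = span ℝ {Y}) (hY0 : Y ≠ 0) (i : ℤ) :
    finrank ℝ (contact π V' B i) + 1 = n := by
  have hinj : Function.Injective
      (π.domRestrict (V' i ⊓ B.orthogonal (LinearMap.ker π))) := by
    rw [← LinearMap.ker_eq_bot, LinearMap.ker_eq_bot']
    exact fun x hx => Subtype.ext (h.lift.inj i x x.2.1 hx)
  have h1 := LinearMap.finrank_range_of_inj hinj
  rw [LinearMap.range_domRestrict] at h1
  have h2 := h.finrank_inf_orthogonal hY hY0 i
  rw [contact]
  omega

theorem exists_form_ne_zero (h : IsIsotropicLift π V V' H' B) (hn : 3 ≤ n) (hn' : n < 5) {Y : Z}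
    (hY : LinearMap.ker B = span ℝ {Y}) (hY0 : Y ≠ 0)
    (hN : ∀ k, π k = 0 → (∀ k', π k' = 0 → B k k' = 0) → k = 0)
    {A : LinearMap.BilinForm ℝ (Amb n)} (hA : IsInduced π B A) (i : ℤ) :
    ∃ u ∈ V i, A u u ≠ 0 := by
  obtain ⟨k, hk, hkk⟩ : ∃ k, π k = 0 ∧ B k k ≠ 0 := by
    by_contra! hc
    have hpos : 0 < finrank ℝ (LinearMap.ker π) := by
      have := h.finrank_ker
      omega
    obtain ⟨⟨k, hk⟩, hk0⟩ := finrank_pos_iff_exists_ne_zero.1 hpos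
    refine hk0 (Subtype.ext (hN k hk fun k' hk' => ?_))
    have h1 := hc (k + k') (by rw [map_add, hk', LinearMap.mem_ker.1 hk, add_zero])
    simp only [map_add, LinearMap.add_apply, hc k hk, hc k' hk', h.symm k' k] at h1
    linarith
  -- Writing a non-isotropic `k` of N as `y + x` along this sum, isotropy of `y` gives `B x x = -B k
  -- k`, and `π y = -π x` makes this the value of `A` at `π y`.
  have htop : V' i ⊔ B.orthogonal (LinearMap.ker π) = ⊤ := by
    apply eq_top_of_finrank_eq
    have h1 := finrank_sup_add_finrank_inf_eq (V' i) (B.orthogonal (LinearMap.ker π))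
    have h2 := h.finrank_inf_orthogonal hY hY0 i
    rw [h.finrank_V', h.finrank_orthogonal_ker] at h1
    rw [h.finrank_eq]
    omega
  obtain ⟨y, hy, x, hx, hyx⟩ := mem_sup.1 (htop ▸ mem_top : k ∈ V' i ⊔ _)
  have hx' := h.mem_orthogonal.1 hx
  have hπ : π x = -π y := by
    rw [eq_neg_iff_add_eq_zero, ← map_add, add_comm x y, hyx, hk]
  refine ⟨π y, h.lift.map i ▸ mem_map_of_mem hy, ?_⟩
  have h1 : A (π y) (π y) = A (π x) (π x) := by simp [hπ]
  rw [h1, hA.2 x hx']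
  have hy' : y = k - x := by rw [← hyx, add_sub_cancel_right]
  have h2 := h.isotropic i y hy y hy
  rw [hy'] at h2
  simp only [map_sub, LinearMap.sub_apply, hx' k hk, h.symm k x] at h2
  intro h3
  apply hkk
  linarith

theorem touchesAlong (h : IsIsotropicLift π V V' H' B) (hn : 3 ≤ n) (hn' : n < 5)
    (hV : FamilyInGeneralPosition n V)
    (hN : ∀ k, π k = 0 → (∀ k', π k' = 0 → B k k' = 0) → k = 0)
    {A : LinearMap.BilinForm ℝ (Amb n)} (hA : IsInduced π B A)
    {A' : Matrix (Fin (n + 2)) (Fin (n + 2)) ℝ} {c s : ℝ} (hs : s ≠ 0)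
    (hA' : A' = c • lorentz n + s • A.toMatrix') (i : ℤ) :
    finrank ℝ (contact π V' B i) + 1 = n ∧ TouchesAlong n A' (V i) (contact π V' B i) := by
  obtain ⟨Y, hY, hY0, hVY, hYY⟩ := h.exists_apex hV
  have hform : ∀ x y, form A.toMatrix' x y = A x y := fun x y => by
    rw [form_eq_toBilin', Matrix.toBilin'_toMatrix']
  refine ⟨h.finrank_contact hY hY0 i, ?_⟩
  have hBY : ∀ z, B Y z = 0 := mem_ker.1 (hY ▸ mem_span_singleton_self Y)
  refine touchesAlong_of_cone (A := A.toMatrix') ?_ hs hA' (Y := π Y) ?_ ?_ hYY ?_ ?_ ?_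
    (h.nondeg i) (h.span_null i) ?_
  · exact isSymm_toMatrix' hA.1
  · rw [contact, ← h.lift.map i]
    exact map_mono inf_le_left
  · rw [← h.lift.map i]
    exact mem_map_of_mem (h.mem_of_radical i hBY)
  · intro w
    obtain ⟨z, rfl⟩ := h.surj w
    rw [hform, hA.2 Y fun k _ => hBY k, hBY]
  · intro x hx
    obtain ⟨ρ, hρ⟩ : ∃ z, (∀ k, π k = 0 → B z k = 0) ∧ π z = x := by
      obtain ⟨z, hz⟩ := h.surj x
      have hd : LinearMap.ker π ⊔ B.orthogonal (LinearMap.ker π) = ⊤ := by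
        apply eq_top_of_finrank_eq
        have h1 := finrank_sup_add_finrank_inf_eq (LinearMap.ker π)
          (B.orthogonal (LinearMap.ker π))
        have h2 : LinearMap.ker π ⊓ B.orthogonal (LinearMap.ker π) = ⊥ := by
          rw [eq_bot_iff]
          rintro k ⟨hk, hk'⟩
          exact hN k hk (h.mem_orthogonal.1 hk')
        have h3 := h.finrank_ker
        rw [h2, finrank_bot, h.finrank_orthogonal_ker] at h1
        rw [h.finrank_eq]
        omega
      obtain ⟨k, hk, y, hy, rfl⟩ := mem_sup.1 (hd ▸ mem_top : z ∈ LinearMap.ker π ⊔ _)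
      refine ⟨y, h.mem_orthogonal.1 hy, ?_⟩
      rw [← hz, map_add, LinearMap.mem_ker.1 hk, zero_add]
    obtain ⟨hρ1, rfl⟩ := hρ
    have hker : ρ ∈ LinearMap.ker B := mem_ker.2 fun z => by
      rw [← hA.2 ρ hρ1, ← hform, hx]
    rw [hY, mem_span_singleton] at hker
    obtain ⟨t, rfl⟩ := hker
    exact ⟨t, map_smul _ _ _⟩
  · rintro _ ⟨x, ⟨hx, hx'⟩, rfl⟩ u hu
    rw [← h.lift.map i] at hu
    obtain ⟨y, hy, rfl⟩ := hu
    rw [hform, hA.2 x (h.mem_orthogonal.1 hx')]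
    exact h.isotropic i x hx y hy
  · simpa only [hform] using h.exists_form_ne_zero hn hn' hY hY0 hN hA i

theorem isTransversal_contact (h : IsIsotropicLift π V V' H' B) (hn : 3 ≤ n)
    (hV : FamilyInGeneralPosition n V) (i : ℤ) (ht : PolarTangentTransversal n V i) :
    IsTransversal n (contact π V' B i) := by
  obtain ⟨Y, hY, hY0, hVY, -⟩ := h.exists_apex hV
  obtain ⟨σ, Ψ, hσ, hΨ, hc⟩ := h.exists_dual_quadric hn hY hY0 hVY
  have hBY : ∀ z, B Y z = 0 := mem_ker.1 (hY ▸ mem_span_singleton_self Y)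
  -- The tangent space of `Ψ` along the polar space of `V i` is the polar space of the contact
  -- space; a subspace is nondegenerate as soon as its polar space is.
  have hT := ht Ψ hc (polarSpace n (contact π V' B i)) fun w => by
    constructor
    · intro hw
      rw [mem_polarSpace] at hw
      have hwP : w ∈ polarSpace n (⨅ i, V i) := by
        rw [hVY, mem_polarSpace_singleton]
        exact hw _ (mem_map_of_mem ⟨h.mem_of_radical i hBY,
          h.mem_orthogonal.2 fun k _ => hBY k⟩)
      refine ⟨⟨w, hwP⟩, rfl, fun x hx => ?_⟩
      rw [hΨ, h.symm, hσ w hwP]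
      refine hw _ (mem_map_of_mem ⟨h.mem_of_orthogonal hY hY0 i fun y hy => ?_,
        h.mem_orthogonal.2 fun k hk => ?_⟩)
      · rw [hσ x x.2]
        exact mem_polarSpace.1 hx _ (h.lift.map i ▸ mem_map_of_mem hy)
      · rw [hσ x x.2, LinearMap.mem_ker.1 hk, map_zero]
    · rintro ⟨z, rfl, hz⟩
      rw [mem_polarSpace]
      rintro _ ⟨x, ⟨hx, hx'⟩, rfl⟩
      obtain ⟨y, hy⟩ := h.exists_descent (z := x) fun k hk => h.mem_orthogonal.1 hx' k hk
      have hyP : y ∈ polarSpace n (⨅ i, V i) := by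
        rw [hVY, mem_polarSpace_singleton, ← hy, h.symm, hBY]
      have := hz ⟨y, hyP⟩ (mem_polarSpace.2 fun u hu => by
        rw [← h.lift.map i] at hu
        obtain ⟨v, hv, rfl⟩ := hu
        rw [← hy]
        exact h.isotropic i x hx v hv)
      rw [hΨ, hσ y hyP, ← hy, h.symm, hσ z z.2] at this
      exact this
  intro x hx hxE
  refine hT x (mem_polarSpace.2 fun u hu => ?_) fun y hy => ?_
  · rw [← form_lorentz, hxE u hu]
  · exact hy x hx

end IsIsotropicLift

end DarbouxNet

/-! ### Assembly of the cyclides. -/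

namespace DarbouxNet

open Submodule Module

variable {n : ℕ} {M : ℤ → ℤ → ProjSpace n} {V H : ℤ → Submodule ℝ (Amb n)}

theorem toMatrix'_lorentzForm : (lorentzForm n).toMatrix' = lorentz n :=
  LinearMap.BilinForm.toMatrix'_toBilin' _

theorem isCyclideMatrix_of_not_subset {B : Matrix (Fin (n + 2)) (Fin (n + 2)) ℝ} (hB : B.IsSymm)
    {U : Submodule ℝ (Amb n)} (h : ¬ sphereOf n U ⊆ darbouxCyclide n B) : IsCyclideMatrix n B := by
  refine ⟨hB, ?_⟩
  rintro c rfl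
  refine h fun p hp => ⟨?_, hp.2⟩
  have h1 : form (lorentz n) p.rep p.rep = 0 := hp.2
  change form (c • lorentz n) p.rep p.rep = 0
  simp only [form, Matrix.smul_mulVec, dotProduct_smul] at h1 ⊢
  rw [h1, smul_zero]

theorem isIsotropicLift {Z : Type*} [AddCommGroup Z] [Module ℝ Z] {π : Z →ₗ[ℝ] Amb n}
    {V' H' : ℤ → Submodule ℝ Z} {m : ℤ → ℤ → Amb n} {m' : ℤ → ℤ → Z}
    (hZ : finrank ℝ Z = 7) (hπ : Function.Surjective π) (h : IsQNet m V H)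
    (hm : ∀ i j, lorentzForm n (m i j) (m i j) = 0)
    (hmm : ∀ i, lorentzForm n (m i 0) (m i 1) ≠ 0) (h' : IsQNet m' V' H')
    (hV : IsFamilyLift π V V') (hH : IsFamilyLift π H H')
    {B : LinearMap.BilinForm ℝ Z} (hB : ∀ x y, B x y = B y x)
    (hBV : ∀ i, ∀ x ∈ V' i, ∀ y ∈ V' i, B x y = 0)
    (hBH : ∀ x ∈ H' 0, ∀ y ∈ H' 0, B x y = lorentzForm n (π x) (π y)) :
    IsIsotropicLift π V V' (H' 0) B where
  finrank_eq := hZ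
  surj := hπ
  lift := hV
  finrank_V' := h'.finrank_V
  symm := hB
  isotropic := hBV
  finrank_H' := h'.finrank_H 0
  inj_H' := hH.inj 0
  eq_on_H' := hBH
  nondeg i _ hx h0 := eq_zero_of_orthogonal (h.mem_V i 0) (h.mem_V i 1) (hm _ _) (hmm i) hx h0
  span_null i := ⟨_, by rintro _ ⟨k, rfl⟩; exact hm _ _, h.span_V i 0⟩

theorem lorentzForm_rep_self (hM : IsCircularNet n M) (i j : ℤ) :
    lorentzForm n (M i j).rep (M i j).rep = 0 := mem_mobiusQuadric.1 (hM.mem_mobius i j)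

theorem exists_touching_cyclide (hn : 3 ≤ n) (hn' : n < 5) (hM : IsCircularNet n M)
    (hV : ∀ i, finrank ℝ (V i) = 4) (hH : ∀ j, finrank ℝ (H j) = 4)
    (hMV : ∀ i j, M i j ∈ sphereOf n (V i)) (hMH : ∀ i j, M i j ∈ sphereOf n (H j))
    (hgen : NetInGeneralPosition n M V H) (hVg : FamilyInGeneralPosition n V)
    (hHg : FamilyInGeneralPosition n H) :
    ∃ B, IsCyclideMatrix n B ∧
      (∀ i, ∃ E : Submodule ℝ (Amb n), finrank ℝ E + 1 = n ∧ TouchesAlong n B (V i) E ∧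
        (PolarTangentTransversal n V i → IsTransversal n E)) ∧
      (∀ j, ∃ E : Submodule ℝ (Amb n), finrank ℝ E + 1 = n ∧ TouchesAlong n B (H j) E ∧
        (PolarTangentTransversal n H j → IsTransversal n E)) := by
  have hq := isQNet_of_isCircularNet hM hV hH hMV hMH hgen
  have hm := lorentzForm_rep_self hM
  obtain ⟨Z, _, _, _, π, m', V', H', hZ, hπ, hq', htop, hm', hVl, hHl⟩ :=
    hq.exists_lift (sup_eq_top hgen hq)
  let L : LinearMap.BilinForm ℝ Z := (lorentzForm n).compl₁₂ π π
  have hL : ∀ x y, L x y = lorentzForm n (π x) (π y) := fun x y => rfl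
  have hLk : ∀ x k, π k = 0 → L x k = 0 := fun x k hk => by rw [hL, hk, map_zero]
  obtain ⟨B, hB, hBV, hBH⟩ := hq'.exists_form hZ htop L (fun x y => lorentzForm_comm _ _)
    fun i j => by rw [hL, hm', hm]
  have hlV : IsIsotropicLift π V V' (H' 0) B := isIsotropicLift hZ hπ hq hm
    (fun i => lorentzForm_rep_ne_zero (hM.mem_mobius _ _) (hM.mem_mobius _ _)
      (hgen.quad_distinct i 0).2.1) hq' hVl hHl hB hBV (hBH 0)
  -- The two families play symmetric roles under the exchange of `B` and `L - B`.
  have hlH : IsIsotropicLift π H H' (V' 0) (L - B) := isIsotropicLift hZ hπ hq.swap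
    (fun i j => hm j i)
    (fun j => lorentzForm_rep_ne_zero (hM.mem_mobius _ _) (hM.mem_mobius _ _)
      (hgen.quad_distinct 0 j).1) hq'.swap hHl hVl
    (fun x y => by simp only [LinearMap.sub_apply, hB x y, hL, lorentzForm_comm (π x)])
    (fun j x hx y hy => by rw [LinearMap.sub_apply, LinearMap.sub_apply, hBH j x hx y hy, sub_self])
    (fun x hx y hy => by
      rw [LinearMap.sub_apply, LinearMap.sub_apply, hBV 0 x hx y hy, sub_zero, hL])
  have hCk : ∀ x k, π k = 0 → (L - B) x k = -B x k := fun x k hk => by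
    rw [LinearMap.sub_apply, LinearMap.sub_apply, hLk x k hk, zero_sub]
  have hN : ∀ k, π k = 0 → (∀ k', π k' = 0 → B k k' = 0) → k = 0 :=
    fun k => hlV.eq_zero_of_mem_ker hn hVg
  have hN' : ∀ k, π k = 0 → (∀ k', π k' = 0 → (L - B) k k' = 0) → k = 0 := fun k hk h =>
    hN k hk fun k' hk' => by rw [← neg_eq_zero, ← hCk k k' hk', h k' hk']
  obtain ⟨A, hA⟩ := hlV.exists_isInduced hN
  have hA' : IsIsotropicLift.IsInduced π (L - B) (lorentzForm n - A) := by
    refine ⟨fun x y => ?_, fun x hx y => ?_⟩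
    · simp only [LinearMap.sub_apply, hA.1 x y, lorentzForm_comm x y]
    · simp only [LinearMap.sub_apply, hL]
      rw [hA.2 x fun k hk => by rw [← neg_eq_zero, ← hCk x k hk, hx k hk]]
  have hVt := hlV.touchesAlong hn hn' hVg hN hA (A' := A.toMatrix') (c := 0) one_ne_zero (by simp)
  -- `A = ⟨·,·⟩ - (⟨·,·⟩ - A)`: the contours of both families lie in one pencil with the Möbius
  -- quadric, so the same matrix serves for the `H j`.
  have hHt := hlH.touchesAlong hn hn' hHg hN' hA' (A' := A.toMatrix') (c := 1) (s := -1)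
    (by norm_num) (by
      rw [← toMatrix'_lorentzForm]
      ext a b
      simp only [Matrix.add_apply, Matrix.smul_apply, LinearMap.BilinForm.toMatrix'_apply,
        LinearMap.sub_apply, smul_eq_mul]
      ring)
  exact ⟨A.toMatrix', isCyclideMatrix_of_not_subset (isSymm_toMatrix' hA.1) (hVt 0).2.2.1,
    fun i => ⟨_, (hVt i).1, (hVt i).2, hlV.isTransversal_contact hn hVg i⟩,
    fun j => ⟨_, (hHt j).1, (hHt j).2, hlH.isTransversal_contact hn hHg j⟩⟩

theorem exists_containing_cyclide (hn : n = 5) (hM : IsCircularNet n M)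
    (hV : ∀ i, finrank ℝ (V i) = 4) (hH : ∀ j, finrank ℝ (H j) = 4)
    (hMV : ∀ i j, M i j ∈ sphereOf n (V i)) (hMH : ∀ i j, M i j ∈ sphereOf n (H j))
    (hgen : NetInGeneralPosition n M V H) :
    ∃ B, IsCyclideMatrix n B ∧ (∀ i, sphereOf n (V i) ⊆ darbouxCyclide n B) ∧
      ∀ j, sphereOf n (H j) ⊆ darbouxCyclide n B := by
  have hq := isQNet_of_isCircularNet hM hV hH hMV hMH hgen
  obtain ⟨B, hB, hBV, hBH⟩ := hq.exists_form (by rw [finrank_fin_fun, hn]) (sup_eq_top hgen hq)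
    (lorentzForm n) lorentzForm_comm (lorentzForm_rep_self hM)
  have hform : ∀ x y, form B.toMatrix' x y = B x y := fun x y => by
    rw [form_eq_toBilin', Matrix.toBilin'_toMatrix']
  refine ⟨B.toMatrix', ⟨isSymm_toMatrix' hB, fun c hc => ?_⟩, fun i p hp => ⟨?_, hp.2⟩,
    fun j p hp => ⟨?_, hp.2⟩⟩
  -- If `B` were `c` times the Lorentz product, two distinct vertices in `V 0` would force `c = 0`;
  -- then the product would vanish on `H 0`, which also contains two distinct vertices.
  · have hc' : ∀ x y, B x y = c * lorentzForm n x y := fun x y => by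
      rw [← hform, hc, ← form_lorentz]
      simp [form, Matrix.smul_mulVec]
    have h1 := hBV 0 _ (hq.mem_V 0 0) _ (hq.mem_V 0 1)
    rw [hc'] at h1
    have hc0 := (mul_eq_zero.1 h1).resolve_right (lorentzForm_rep_ne_zero (hM.mem_mobius _ _)
      (hM.mem_mobius _ _) (hgen.quad_distinct 0 0).2.1)
    have h2 := hBH 0 _ (hq.mem_H 0 0) _ (hq.mem_H 1 0)
    rw [hc', hc0, zero_mul] at h2
    exact lorentzForm_rep_ne_zero (hM.mem_mobius _ _) (hM.mem_mobius _ _)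
      (hgen.quad_distinct 0 0).1 h2.symm
  · change form B.toMatrix' p.rep p.rep = 0
    rw [hform]
    exact hBV i _ (rep_mem_of_mem_sphereOf hp) _ (rep_mem_of_mem_sphereOf hp)
  · change form B.toMatrix' p.rep p.rep = 0
    rw [hform, hBH j _ (rep_mem_of_mem_sphereOf hp) _ (rep_mem_of_mem_sphereOf hp)]
    exact mem_mobiusQuadric.1 hp.2

end DarbouxNet

theorem mainTheorem10 (n : ℕ) (M : ℤ → ℤ → DarbouxNet.ProjSpace n)
    (V H : ℤ → Submodule ℝ (DarbouxNet.Amb n))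
    (hM : DarbouxNet.IsCircularNet n M)
    (hV : ∀ i, Module.finrank ℝ (V i) = 4) (hH : ∀ j, Module.finrank ℝ (H j) = 4)
    (hMV : ∀ i j, M i j ∈ DarbouxNet.sphereOf n (V i))
    (hMH : ∀ i j, M i j ∈ DarbouxNet.sphereOf n (H j))
    (hgen : DarbouxNet.NetInGeneralPosition n M V H) :
    (n = 5 → ∃ B, DarbouxNet.IsCyclideMatrix n B ∧
      (∀ i, DarbouxNet.sphereOf n (V i) ⊆ DarbouxNet.darbouxCyclide n B) ∧
      (∀ j, DarbouxNet.sphereOf n (H j) ⊆ DarbouxNet.darbouxCyclide n B)) ∧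
    (n = 4 → DarbouxNet.FamilyInGeneralPosition n V → DarbouxNet.FamilyInGeneralPosition n H →
      ∃ B, DarbouxNet.IsCyclideMatrix n B ∧
      (∀ i, ∃ E : Submodule ℝ (DarbouxNet.Amb n), Module.finrank ℝ E = 3 ∧
        DarbouxNet.TouchesAlong n B (V i) E ∧
        (DarbouxNet.PolarTangentTransversal n V i → DarbouxNet.IsTransversal n E)) ∧
      (∀ j, ∃ E : Submodule ℝ (DarbouxNet.Amb n), Module.finrank ℝ E = 3 ∧
        DarbouxNet.TouchesAlong n B (H j) E ∧
        (DarbouxNet.PolarTangentTransversal n H j → DarbouxNet.IsTransversal n E))) ∧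
    (n = 3 → DarbouxNet.FamilyInGeneralPosition n V → DarbouxNet.FamilyInGeneralPosition n H →
      ∃ B, DarbouxNet.IsCyclideMatrix n B ∧
      (∀ i, ∃ E : Submodule ℝ (DarbouxNet.Amb n), Module.finrank ℝ E = 2 ∧
        DarbouxNet.TouchesAlong n B (V i) E ∧
        (DarbouxNet.PolarTangentTransversal n V i → DarbouxNet.IsTransversal n E)) ∧
      (∀ j, ∃ E : Submodule ℝ (DarbouxNet.Amb n), Module.finrank ℝ E = 2 ∧
        DarbouxNet.TouchesAlong n B (H j) E ∧
        (DarbouxNet.PolarTangentTransversal n H j → DarbouxNet.IsTransversal n E))) := by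
  refine ⟨fun hn => DarbouxNet.exists_containing_cyclide hn hM hV hH hMV hMH hgen,
    fun hn hVg hHg => ?_, fun hn hVg hHg => ?_⟩
  all_goals
    obtain ⟨B, hB, h1, h2⟩ := DarbouxNet.exists_touching_cyclide (by omega) (by omega)
      hM hV hH hMV hMH hgen hVg hHg
    refine ⟨B, hB, fun i => ?_, fun j => ?_⟩
    · obtain ⟨E, hE, h⟩ := h1 i
      exact ⟨E, by omega, h⟩
    · obtain ⟨E, hE, h⟩ := h2 j
      exact ⟨E, by omega, h⟩
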